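/- Let $(X,\mathcal O_X)$ be a ringed space (with a sheaf of commutative rings), let $Q$ be a finite quiver with vertex set $Q_0$, arrow set $Q_1$, and head and tail maps $h,t\colon Q_1\to Q_0$, and for each $a\in Q_1$ let $M_a$ be a locally free sheaf of $\mathcal O_X$-modules. An $M$-twisted $Q$-sheaf $(V,\phi)$ consists of $\mathcal O_X$-modules $V_i$ $(i\in Q_0)$ and morphisms $\phi_a\colon M_a\otimes_{\mathcal O_X}V_{ta}\to V_{ha}$ $(a\in Q_1)$; a morphism $(V,\phi)\to(W,\psi)$ is a family of $\mathcal O_X$-linear maps $f_i\colon V_i\to W_i$ with $f_{ha}\circ\phi_a=\psi_a\circ(1\otimes f_{ta})$ for all $a\in Q_1$. These form an abelian category, equivalent to that of sheaves of modules over the $M$-twisted path algebra $B$ of $Q$ on $X$; we call its objects $B$-modules and write $\mathrm{Hom}_B$ and $\mathrm{Ext}^n_B$ for its Hom and Ext groups. Let $V=(V,\phi)$ and $W=(W,\psi)$ be $B$-modules. Then there is a long exact sequence $$0\to\mathrm{Hom}_B(V,W)\to\bigoplus_{i\in Q_0}\mathrm{Hom}_{\mathcal O_X}(V_i,W_i)\xrightarrow{\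 \partial\ }\bigoplus_{a\in Q_1}\mathrm{Hom}_{\mathcal O_X}(M_a\otimes V_{ta},W_{ha})\to\mathrm{Ext}^1_B(V,W)\to\bigoplus_{i\in Q_0}\mathrm{Ext}^1_{\mathcal O_X}(V_i,W_i)\xrightarrow{\ \partial\ }\bigoplus_{a\in Q_1}\mathrm{Ext}^1_{\mathcal O_X}(M_a\otimes V_{ta},W_{ha})\to\mathrm{Ext}^2_B(V,W)\to\cdots$$ continuing in all degrees. The maps $\mathrm{Hom}_B(V,W)\to\bigoplus_i\mathrm{Hom}_{\mathcal O_X}(V_i,W_i)$ and $\mathrm{Ext}^n_B(V,W)\to\bigoplus_i\mathrm{Ext}^n_{\mathcal O_X}(V_i,W_i)$ are those induced by the exact forgetful functors $V\mapsto V_i$, and in every degree $n\ge 0$ the map $\partial$ is $$\partial\colon (f_i)_{i\in Q_0}\longmapsto\bigl(f_{ha}\circ\phi_a-\psi_a\circ(1\otimes f_{ta})\bigr)_{a\in Q_1},$$ where $\circ$ is the Yoneda product and $1\otimes f_{ta}\in\mathrm{Ext}^n_{\mathcal O_X}(M_a\otimes V_{ta},M_a\otimes W_{ta})$ is the image of $f_{ta}\in\mathrm{Ext}^n_{\mathcal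 O_X}(V_{ta},W_{ta})$ under the exact functor $M_a\otimes_{\mathcal O_X}-$. -/

import Mathlib

open CategoryTheory Limits MonoidalCategory Opposite AlgebraicGeometry

open scoped TensorProduct

universe v u w₀ w₁ e e'

set_option linter.unusedSectionVars false

namespace QuiverSheaf

/-- A quiver is given by its head and tail maps `h t : Q₁ → Q₀`.  For an endofunctor `T a` of `A`
attached to every arrow `a`, a `T`-twisted representation consists of an object `obj i` for every
vertex `i` and a morphism `φ a : T a (obj (t a)) ⟶ obj (h a)` for every arrow `a`. -/
structure TwistedRep {A : Type u} [Category.{v} A] {Q₀ : Type w₀} {Q₁ : Type w₁}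
    (h t : Q₁ → Q₀) (T : Q₁ → A ⥤ A) where
  obj : Q₀ → A
  φ : ∀ a : Q₁, (T a).obj (obj (t a)) ⟶ obj (h a)

namespace TwistedRep

variable {A : Type u} [Category.{v} A] {Q₀ : Type w₀} {Q₁ : Type w₁}
  {h t : Q₁ → Q₀} {T : Q₁ → A ⥤ A}

/-- Morphisms of twisted representations: families of morphisms `app i` with
`ψ_a ∘ T_a(f_{ta}) = f_{ha} ∘ φ_a` for every arrow `a`. -/
@[ext]
structure Hom (V W : TwistedRep h t T) where
  app : ∀ i : Q₀, V.obj i ⟶ W.obj i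
  comm : ∀ a : Q₁, (T a).map (app (t a)) ≫ W.φ a = V.φ a ≫ app (h a)

instance : Category (TwistedRep h t T) where
  Hom := Hom
  id V := { app := fun i => 𝟙 _, comm := fun a => by simp }
  comp f g :=
    { app := fun i => f.app i ≫ g.app i
      comm := fun a => by
        rw [Functor.map_comp, Category.assoc, g.comm, ← Category.assoc, f.comm, Category.assoc] }

@[ext]
theorem hom_ext {V W : TwistedRep h t T} {f g : V ⟶ W} (H : ∀ i, f.app i = g.app i) : f = g :=
  Hom.ext (funext H)

@[simp] theorem id_app (V : TwistedRep h t T) (i : Q₀) : Hom.app (𝟙 V) i = 𝟙 (V.obj i) := rfl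

@[simp] theorem comp_app {U V W : TwistedRep h t T} (f : U ⟶ V) (g : V ⟶ W) (i : Q₀) :
    (f ≫ g).app i = f.app i ≫ g.app i := rfl

/-- The forgetful functor `(V, φ) ↦ V_i`. -/
@[simps]
def eval (h t : Q₁ → Q₀) (T : Q₁ → A ⥤ A) (i : Q₀) : TwistedRep h t T ⥤ A where
  obj V := V.obj i
  map f := f.app i

section Preadd

variable [Preadditive A] [∀ a, (T a).Additive]

instance (V W : TwistedRep h t T) : Add (V ⟶ W) where
  add f g :=
    { app := fun i => f.app i + g.app i
      comm := fun a => by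
        rw [Functor.map_add, Preadditive.add_comp, Preadditive.comp_add, f.comm, g.comm] }
instance (V W : TwistedRep h t T) : Zero (V ⟶ W) where
  zero := { app := fun i => 0, comm := fun a => by simp }
instance (V W : TwistedRep h t T) : Neg (V ⟶ W) where
  neg f :=
    { app := fun i => -f.app i
      comm := fun a => by
        rw [Functor.map_neg, Preadditive.neg_comp, Preadditive.comp_neg, f.comm] }

@[simp] theorem add_app {V W : TwistedRep h t T} (f g : V ⟶ W) (i : Q₀) :
    (f + g).app i = f.app i + g.app i := rfl
@[simp] theorem zero_app {V W : TwistedRep h t T} (i : Q₀) : (0 : V ⟶ W).app i = 0 := rfl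
@[simp] theorem neg_app {V W : TwistedRep h t T} (f : V ⟶ W) (i : Q₀) :
    (-f).app i = -f.app i := rfl

instance (V W : TwistedRep h t T) : AddCommGroup (V ⟶ W) where
  add_assoc f g k := by ext; simp [add_assoc]
  zero_add f := by ext; simp
  add_zero f := by ext; simp
  nsmul := nsmulRec
  zsmul := zsmulRec
  neg_add_cancel f := by ext; simp
  add_comm f g := by ext; simp [add_comm]

instance : Preadditive (TwistedRep h t T) where
  add_comp _ _ _ f f' g := by ext; simp
  comp_add _ _ _ f g g' := by ext; simp

instance (i : Q₀) : (eval h t T i).Additive where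

end Preadd

section Abel

variable [Abelian A] [∀ a, (T a).Additive]

/-- The pointwise product -/
noncomputable abbrev prod {J : Type} [Finite J] (F : J → TwistedRep h t T) :
    TwistedRep h t T where
  obj i := ∏ᶜ fun j => (F j).obj i
  φ a := Pi.lift fun j => (T a).map (Pi.π _ j) ≫ (F j).φ a

/-- The projections of the pointwise product. -/
noncomputable abbrev prodFan {J : Type} [Finite J] (F : J → TwistedRep h t T) : Fan F :=
  Fan.mk (prod F) fun j => { app := fun i => Pi.π _ j, comm := fun a => by simp [prod] }

noncomputable def prodFanIsLimit {J : Type} [Finite J] (F : J → TwistedRep h t T) :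
    IsLimit (prodFan F) :=
  Fan.IsLimit.mk _
    (fun s => { app := fun i => Pi.lift fun j => (s.proj j).app i
                comm := fun a => by
                  refine limit.hom_ext fun ⟨j⟩ => ?_
                  simp [prod, ← Functor.map_comp_assoc, (s.proj j).comm] })
    (fun s j => by ext i; simp [prodFan])
    (fun s m hm => by
      ext i
      refine limit.hom_ext fun ⟨j⟩ => ?_
      simp [← hm j, prodFan])

instance : HasFiniteProducts (TwistedRep h t T) where
  out n := by
    have : ∀ F : Fin n → TwistedRep h t T, HasProduct F := fun F => ⟨⟨⟨_, prodFanIsLimit F⟩⟩⟩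
    exact { has_limit := fun F => hasLimit_of_iso (Discrete.natIsoFunctor (F := F)).symm }

/-- The pointwise kernel -/
noncomputable abbrev ker {V W : TwistedRep h t T} (f : V ⟶ W) : TwistedRep h t T where
  obj i := kernel (f.app i)
  φ a := kernel.lift _ ((T a).map (kernel.ι _) ≫ V.φ a) (by
    rw [Category.assoc, ← f.comm, ← Functor.map_comp_assoc, kernel.condition]; simp)

noncomputable abbrev kerι {V W : TwistedRep h t T} (f : V ⟶ W) : ker f ⟶ V where
  app i := kernel.ι _
  comm a := by simp [ker]

theorem kerι_comp {V W : TwistedRep h t T} (f : V ⟶ W) : kerι f ≫ f = 0 := by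
  ext i; simp [kerι]

noncomputable def kerIsLimit {V W : TwistedRep h t T} (f : V ⟶ W) :
    IsLimit (KernelFork.ofι (kerι f) (kerι_comp f)) :=
  KernelFork.IsLimit.ofι _ _
    (fun g hg =>
      { app := fun i => kernel.lift _ (g.app i) (by simpa using congrArg (fun k => k.app i) hg)
        comm := fun a => by
          rw [← cancel_mono (kernel.ι _)]
          simp [ker, ← Functor.map_comp_assoc, g.comm] })
    (fun g hg => by ext i; simp [kerι])
    (fun g hg m hm => by
      refine hom_ext fun i => ?_
      rw [← cancel_mono (kernel.ι _)]
      simp [← hm, kerι])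

instance : HasKernels (TwistedRep h t T) where
  has_limit f := ⟨⟨⟨_, kerIsLimit f⟩⟩⟩

instance mono_app {V W : TwistedRep h t T} (f : V ⟶ W) [Mono f] (i : Q₀) : Mono (f.app i) := by
  have h0 : kerι f = 0 := by rw [← cancel_mono f, kerι_comp, zero_comp]
  have := congrArg (fun k => k.app i) h0
  exact Preadditive.mono_of_kernel_zero this

variable [∀ a, PreservesFiniteColimits (T a)]

/-- The pointwise cokernel -/
noncomputable abbrev coker {V W : TwistedRep h t T} (f : V ⟶ W) : TwistedRep h t T where
  obj i := cokernel (f.app i)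
  φ a := (PreservesCokernel.iso (T a) (f.app (t a))).hom ≫
    cokernel.desc _ (W.φ a ≫ cokernel.π _) (by
      rw [← Category.assoc, f.comm, Category.assoc, cokernel.condition, comp_zero])

theorem coker_φ {V W : TwistedRep h t T} (f : V ⟶ W) (a : Q₁) :
    (T a).map (cokernel.π (f.app (t a))) ≫ (coker f).φ a = W.φ a ≫ cokernel.π (f.app (h a)) := by
  simp [coker]

noncomputable abbrev cokerπ {V W : TwistedRep h t T} (f : V ⟶ W) : W ⟶ coker f where
  app _ := cokernel.π _
  comm a := coker_φ f a

theorem comp_cokerπ {V W : TwistedRep h t T} (f : V ⟶ W) : f ≫ cokerπ f = 0 := by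
  ext i; simp [cokerπ]

noncomputable def cokerIsColimit {V W : TwistedRep h t T} (f : V ⟶ W) :
    IsColimit (CokernelCofork.ofπ (cokerπ f) (comp_cokerπ f)) :=
  CokernelCofork.IsColimit.ofπ _ _
    (fun g hg =>
      { app := fun i => cokernel.desc _ (g.app i) (by simpa using congrArg (fun k => k.app i) hg)
        comm := fun a => by
          rw [← cancel_epi ((T a).map (cokernel.π (f.app (t a)))), ← Functor.map_comp_assoc,
            cokernel.π_desc, g.comm, ← Category.assoc, coker_φ, Category.assoc, cokernel.π_desc] })
    (fun g hg => by ext i; simp [cokerπ])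
    (fun g hg m hm => by
      refine hom_ext fun i => ?_
      rw [← cancel_epi (cokernel.π _)]
      simp [← hm, cokerπ])

instance : HasCokernels (TwistedRep h t T) where
  has_colimit f := ⟨⟨⟨_, cokerIsColimit f⟩⟩⟩

instance epi_app {V W : TwistedRep h t T} (f : V ⟶ W) [Epi f] (i : Q₀) : Epi (f.app i) := by
  have h0 : cokerπ f = 0 := by rw [← cancel_epi f, comp_cokerπ, comp_zero]
  have := congrArg (fun k => k.app i) h0
  exact Preadditive.epi_of_cokernel_zero this

noncomputable abbrev normalMono {V W : TwistedRep h t T} (f : V ⟶ W) [Mono f] : NormalMono f where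
  Z := coker f
  g := cokerπ f
  w := comp_cokerπ f
  isLimit := KernelFork.IsLimit.ofι _ _
    (fun g hg =>
      { app := fun i => Abelian.monoLift (f.app i) (g.app i)
          (by simpa using congrArg (fun k => k.app i) hg)
        comm := fun a => by
          rw [← cancel_mono (f.app (h a)), Category.assoc, Category.assoc, Abelian.monoLift_comp,
            ← f.comm, ← Functor.map_comp_assoc, Abelian.monoLift_comp, g.comm] })
    (fun g hg => by ext i; simp)
    (fun g hg m hm => by ext i; rw [← cancel_mono (f.app i)]; simp [← hm])

noncomputable abbrev normalEpi {V W : TwistedRep h t T} (f : V ⟶ W) [Epi f] : NormalEpi f where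
  W := ker f
  g := kerι f
  w := kerι_comp f
  isColimit := CokernelCofork.IsColimit.ofπ _ _
    (fun g hg =>
      { app := fun i => Abelian.epiDesc (f.app i) (g.app i)
          (by simpa using congrArg (fun k => k.app i) hg)
        comm := fun a => by
          rw [← cancel_epi ((T a).map (f.app (t a))), ← Functor.map_comp_assoc,
            Abelian.comp_epiDesc, g.comm, ← Category.assoc, f.comm, Category.assoc,
            Abelian.comp_epiDesc] })
    (fun g hg => by ext i; simp)
    (fun g hg m hm => by ext i; rw [← cancel_epi (f.app i)]; simp [← hm])

noncomputable instance : Abelian (TwistedRep h t T) where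
  normalMonoOfMono f _ := ⟨normalMono f⟩
  normalEpiOfEpi f _ := ⟨normalEpi f⟩

instance (i : Q₀) : PreservesFiniteLimits (eval h t T i) := by
  have : ∀ {V W : TwistedRep h t T} (f : V ⟶ W), PreservesLimit (parallelPair f 0) (eval h t T i) :=
    fun f => preservesLimit_of_preserves_limit_cone (kerIsLimit f)
      ((KernelFork.isLimitMapConeEquiv _ _).symm (kernelIsKernel (f.app i)))
  exact Functor.preservesFiniteLimits_of_preservesKernels _

instance (i : Q₀) : PreservesFiniteColimits (eval h t T i) := by
  have : ∀ {V W : TwistedRep h t T} (f : V ⟶ W), PreservesColimit (parallelPair f 0) (eval h t T i) :=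
    fun f => preservesColimit_of_preserves_colimit_cocone (cokerIsColimit f)
      ((CokernelCofork.isColimitMapCoconeEquiv _ _).symm (cokernelIsCokernel (f.app i)))
  exact Functor.preservesFiniteColimits_of_preservesCokernels _

end Abel
section ExtMaps

open Abelian

variable [Abelian A] [∀ a, (T a).Additive] [∀ a, PreservesFiniteColimits (T a)]

/-- `f ↦ (f_i)_i` on morphisms. -/
noncomputable def homRes (V W : TwistedRep h t T) : (V ⟶ W) →+ ((i : Q₀) → (V.obj i ⟶ W.obj i)) where
  toFun f i := f.app i
  map_zero' := rfl
  map_add' _ _ := rfl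

/-- `(f_i)_i ↦ (f_{ha} ∘ φ_a - ψ_a ∘ T_a(f_{ta}))_a` on morphisms. -/
noncomputable def homD (V W : TwistedRep h t T) :
    ((i : Q₀) → (V.obj i ⟶ W.obj i)) →+
      ((a : Q₁) → ((T a).obj (V.obj (t a)) ⟶ W.obj (h a))) where
  toFun f a := V.φ a ≫ f (h a) - (T a).map (f (t a)) ≫ W.φ a
  map_zero' := by ext a; simp
  map_add' f g := by
    ext a
    simp only [Pi.add_apply, Functor.map_add, Preadditive.comp_add, Preadditive.add_comp]
    abel

variable [HasExt.{e} A]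

/-- The maps `Ext^n(V, W) ⟶ Ext^n(V_i, W_i)` induced by the exact forgetful functors. -/
noncomputable def extRes [HasExt.{e'} (TwistedRep h t T)] (V W : TwistedRep h t T) (n : ℕ) :
    Ext.{e'} V W n →+ ((i : Q₀) → Ext.{e} (V.obj i) (W.obj i) n) :=
  AddMonoidHom.pi fun i => (eval h t T i).mapExtAddHom V W n

variable [∀ a, PreservesFiniteLimits (T a)]

/-- The map `(f_i)_i ↦ (f_{ha} ∘ φ_a - ψ_a ∘ T_a(f_{ta}))_a` on `Ext^n`.  Here `∘` is the Yoneda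
product (Mathlib's `Ext.comp` takes its factors in diagrammatic order, and `Ext.mk₀` regards a
morphism as a class in `Ext^0`), and `f ↦ T_a(f)` is the map on `Ext^n` induced by the exact
functor `T_a`. -/
noncomputable def extD (V W : TwistedRep h t T) (n : ℕ) :
    ((i : Q₀) → Ext.{e} (V.obj i) (W.obj i) n) →+
      ((a : Q₁) → Ext.{e} ((T a).obj (V.obj (t a))) (W.obj (h a)) n) where
  toFun f a := (Ext.mk₀ (V.φ a)).comp (f (h a)) (zero_add n) -
    ((f (t a)).mapExactFunctor (T a)).comp (Ext.mk₀ (W.φ a)) (add_zero n)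
  map_zero' := by ext a; simp
  map_add' f g := by
    ext a
    simp only [Pi.add_apply, Ext.mapExactFunctor_add, Ext.comp_add, Ext.add_comp]
    abel

end ExtMaps

end TwistedRep


noncomputable section TensorProducts

/-- An equational criterion for the vanishing of a tensor under `M ⊗ f`. -/
theorem exists_relations {A M N P : Type*} [CommRing A] [AddCommGroup M] [AddCommGroup N]
    [AddCommGroup P] [Module A M] [Module A N] [Module A P] (f : N →ₗ[A] P) (x : M ⊗[A] N)
    (hx : f.lTensor M x = 0) :
    ∃ (l k : ℕ) (m : Fin l → M) (n : Fin l → N) (a : Fin l → Fin k → A) (y : Fin k → P),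
      x = ∑ i, m i ⊗ₜ[A] n i ∧ (∀ i, f (n i) = ∑ j, a i j • y j) ∧
      ∀ j, ∑ i, a i j • m i = 0 := by
  obtain ⟨M₁, hM₁, h₁⟩ := TensorProduct.exists_finite_submodule_left_of_setFinite {x}
    (Set.finite_singleton x)
  obtain ⟨x₁, rfl⟩ := h₁ (Set.mem_singleton x)
  have h0 : (M₁.subtype.rTensor P) (f.lTensor M₁ x₁) = 0 := by
    rw [← hx, ← LinearMap.comp_apply, ← LinearMap.comp_apply, LinearMap.rTensor_comp_lTensor,
      LinearMap.lTensor_comp_rTensor]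
  obtain ⟨M₂, h12, hM₂, h₂⟩ := TensorProduct.eq_zero_of_fg_of_subtype_eq_zero
    (Module.Finite.iff_fg.1 hM₁) h0
  obtain ⟨l, m, hm⟩ := Submodule.fg_iff_exists_fin_generating_family.1 hM₂
  have hm2 : ∀ i, m i ∈ M₂ := fun i => hm ▸ Submodule.subset_span ⟨i, rfl⟩
  let m' : Fin l → M₂ := fun i => ⟨m i, hm2 i⟩
  have hm' : Submodule.span A (Set.range m') = ⊤ := by
    apply Submodule.map_injective_of_injective M₂.injective_subtype
    rw [Submodule.map_span, ← Set.range_comp, Submodule.map_top, Submodule.range_subtype]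
    exact hm
  have key : ∀ z : M₂ ⊗[A] N, ∃ n : Fin l → N, z = ∑ i, m' i ⊗ₜ[A] n i := by
    intro z
    induction z using TensorProduct.induction_on with
    | zero => exact ⟨0, by simp⟩
    | tmul z n =>
      have : z ∈ Submodule.span A (Set.range m') := hm' ▸ Submodule.mem_top
      obtain ⟨c, rfl⟩ := (Submodule.mem_span_range_iff_exists_fun A).1 this
      exact ⟨fun i => c i • n, by simp [TensorProduct.sum_tmul, TensorProduct.smul_tmul]⟩
    | add z w hz hw =>
      obtain ⟨n, rfl⟩ := hz
      obtain ⟨n', rfl⟩ := hw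
      exact ⟨n + n', by simp [TensorProduct.tmul_add, Finset.sum_add_distrib]⟩
  obtain ⟨n, hn⟩ := key ((Submodule.inclusion h12).rTensor N x₁)
  have h3 : ∑ i, m' i ⊗ₜ[A] f (n i) = 0 := by
    rw [← h₂, ← LinearMap.comp_apply, LinearMap.rTensor_comp_lTensor,
      ← LinearMap.lTensor_comp_rTensor, LinearMap.comp_apply, hn]
    simp
  obtain ⟨k, a, y, h4, h5⟩ := TensorProduct.vanishesTrivially_of_sum_tmul_eq_zero A hm' h3
  refine ⟨l, k, m, n, a, y, ?_, h4, fun j => ?_⟩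
  · have : M₁.subtype = M₂.subtype ∘ₗ Submodule.inclusion h12 := rfl
    rw [this, LinearMap.rTensor_comp, LinearMap.comp_apply, hn]
    simp [m']
  · simpa [m'] using congrArg M₂.subtype (h5 j)


variable {C : Type u} [SmallCategory C] {J : GrothendieckTopology C} 

section
variable {R₀ : Cᵒᵖ ⥤ CommRingCat.{u}}

/-- Presheaves of modules over a presheaf of commutative rings. -/
abbrev PMod (R₀ : Cᵒᵖ ⥤ CommRingCat.{u}) := PresheafOfModules.{u} (R₀ ⋙ forget₂ CommRingCat.{u} RingCat.{u})

/-- Sections of the presheaf tensor product. -/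
abbrev Tens (M P : PMod R₀) (U : Cᵒᵖ) : Type u :=
  TensorProduct ((R₀ ⋙ forget₂ CommRingCat.{u} RingCat.{u}).obj U) (M.obj U) (P.obj U)

def tres (M P : PMod R₀) {U V : Cᵒᵖ} (g : U ⟶ V) : Tens M P U →+ Tens M P V :=
  ((M ⊗ P).presheaf.map g).hom

def res (M : PMod R₀) {U V : Cᵒᵖ} (g : U ⟶ V) : M.obj U →+ M.obj V := (M.presheaf.map g).hom

def rres (R₀ : Cᵒᵖ ⥤ CommRingCat.{u}) {U V : Cᵒᵖ} (g : U ⟶ V) :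
    (R₀ ⋙ forget₂ CommRingCat.{u} RingCat.{u}).obj U →+* (R₀ ⋙ forget₂ CommRingCat.{u} RingCat.{u}).obj V := 
    ((R₀ ⋙ forget₂ CommRingCat.{u} RingCat.{u}).map g).hom

theorem tres_tmul (M P : PMod R₀) {U V : Cᵒᵖ} (g : U ⟶ V) (m : M.obj U) (p : P.obj U) :
    tres M P g (m ⊗ₜ p) = res M g m ⊗ₜ res P g p := rfl

theorem res_smul (M : PMod R₀) {U V : Cᵒᵖ} (g : U ⟶ V) (r) (m : M.obj U) :
    res M g (r • m) = rres R₀ g r • res M g m := M.map_smul g r m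

theorem res_comp (M : PMod R₀) {U V W : Cᵒᵖ} (g : U ⟶ V) (k : V ⟶ W) (m : M.obj U) :
    res M (g ≫ k) m = res M k (res M g m) := by
  simp [res]; rfl

theorem res_app {M N : PMod R₀} (f : M ⟶ N) {U V : Cᵒᵖ} (g : U ⟶ V) (m : M.obj U) :
    (f.app V).hom (res M g m) = res N g ((f.app U).hom m) := PresheafOfModules.naturality_apply f g m

theorem whiskerLeft_locallySurjective (M : PMod R₀) {P₁ P₂ : PMod R₀} (f : P₁ ⟶ P₂) [hf : PresheafOfModules.IsLocallySurjective J f] :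
   PresheafOfModules.IsLocallySurjective J (M ◁ f) where
  imageSieve_mem {U} s := by
    let T : Tens M P₂ (op U) → Sieve U := fun s => 
      Presheaf.imageSieve ((PresheafOfModules.toPresheaf (R₀ ⋙ forget₂ CommRingCat RingCat)).map (M ◁ f)) s
    have hT : ∀ (s : Tens M P₂ (op U)) (V : C) (g : V ⟶ U), T s g ↔ ∃ t : Tens M P₁ (op V),
      (f.app (op V)).hom.lTensor (M.obj (op V)) t = tres M P₂ g.op s := fun s V g => Iff.rfl
    change T s ∈ J U
    change Tens M P₂ (op U) at s
    induction s using TensorProduct.induction_on with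
    | zero => 
      refine J.superset_covering ?_ (J.top_mem U)
      intro V g _
      exact (hT _ _ _).2 ⟨0, by simp⟩
    | tmul m n => 
      refine J.superset_covering ?_ (hf.imageSieve_mem n)
      rintro V g ⟨t, ht⟩
      change P₁.obj (op V) at t
      refine (hT _ _ _).2 ⟨res M g.op m ⊗ₜ t, ?_⟩
      rw [LinearMap.lTensor_tmul, tres_tmul]
      exact congrArg _ ht
    | add x y hx hy =>
      refine J.superset_covering ?_ (J.intersection_covering hx hy)
      rintro V g ⟨h1, h2⟩
      obtain ⟨t1, h1⟩ := (hT _ _ _).1 h1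
      obtain ⟨t2, h2⟩ := (hT _ _ _).1 h2
      exact (hT _ _ _).2 ⟨t1 + t2, by rw [map_add, map_add, h1, h2]⟩

theorem inj_iff {M N : PMod R₀} (f : M ⟶ N) : PresheafOfModules.IsLocallyInjective J f ↔
    ∀ (U : Cᵒᵖ) (x : M.obj U), (f.app U).hom x = 0 → ∃ S ∈ J U.unop, ∀ V (g : V ⟶ U.unop), S g → res M g.op x = 0 := by
  constructor
  · intro hf U x hx
    refine ⟨_, hf.equalizerSieve_mem (X := U) x (0 : M.obj U) ?_, fun V g hg => ?_⟩
    · exact hx.trans (map_zero (f.app U).hom).symm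
    · exact Eq.trans hg (map_zero (res M g.op))
  · intro H
    refine ⟨fun {U} x y hxy => ?_⟩
    change M.obj U at x y
    obtain ⟨S, hS, h⟩ := H U (x - y) (by rw [map_sub]; exact sub_eq_zero.2 hxy)
    refine J.superset_covering (fun V g hg => ?_) hS
    have := h V g hg
    rw [map_sub, sub_eq_zero] at this
    exact this

theorem tens_inj_aux (M : PMod R₀) {P₁ P₂ : PMod R₀} (f : P₁ ⟶ P₂)
   (H : ∀ (U : Cᵒᵖ) (x : Tens M P₁ U), (f.app U).hom.lTensor (M.obj U) x = 0 → ∃ S ∈ J U.unop, ∀ V (g : V ⟶ U.unop), S g → tres M P₁ g.op x = 0) :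
   PresheafOfModules.IsLocallyInjective J (M ◁ f) := by
  rw [inj_iff]
  intro U x hx
  exact H U x hx

/-- Finitely many covering conditions hold simultaneously on a covering. -/
theorem fin_cover {P : PMod R₀} {l : ℕ} {U : C} (y : Fin l → P.obj (op U)) (p : ∀ V : C, P.obj (op V) → Prop)
    (H : ∀ j, ∃ S ∈ J U, ∀ V (g : V ⟶ U), S g → p V (res P g.op (y j))) :
    ∃ S ∈ J U, ∀ V (g : V ⟶ U), S g → ∀ j, p V (res P g.op (y j)) := by
  induction l with
  | zero => exact ⟨⊤, J.top_mem U, fun V g _ j => j.elim0⟩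
  | succ l ih =>
    obtain ⟨S, hS, h⟩ := ih (fun j => y j.succ) (fun j => H j.succ)
    obtain ⟨S', hS', h'⟩ := H 0
    exact ⟨S ⊓ S', J.intersection_covering hS hS', fun V g hg => Fin.cases (h' V g hg.2) (h V g hg.1)⟩

theorem whiskerLeft_locallyInjective (M : PMod R₀) {P₁ P₂ : PMod R₀} (f : P₁ ⟶ P₂) [hf : PresheafOfModules.IsLocallySurjective J f]
    [hf' : PresheafOfModules.IsLocallyInjective J f] :
    PresheafOfModules.IsLocallyInjective J (M ◁ f) := by
  refine tens_inj_aux M f fun U x hx => ?_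
  obtain ⟨l, k, m, n, a, y, rfl, h1, h2⟩ := exists_relations (f.app U).hom x hx
  obtain ⟨S, hS, hy⟩ := fin_cover (J := J) (U := U.unop) y (fun V z => ∃ w, (f.app (op V)).hom w = z)
    (fun j => ⟨_, hf.imageSieve_mem (U := U.unop) (y j), fun V g hg => hg⟩)
  have key : ∀ V (g : V ⟶ U.unop), S g → Presheaf.equalizerSieve
    (F := (M ⊗ P₁).presheaf) (X := op V) (tres M P₁ g.op (∑ i, m i ⊗ₜ n i)) (0 : Tens M P₁ (op V)) ∈ J V := by
    intro V g hg
    choose z hz using hy V g hg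
    have h3 : ∀ i, (f.app (op V)).hom (res P₁ g.op (n i) - ∑ j, rres R₀ g.op (a i j) • z j) = 0 := by
      intro i
      rw [map_sub, map_sum, res_app, h1, map_sum, sub_eq_zero]
      refine Finset.sum_congr rfl fun j _ => ?_
      rw [res_smul, map_smul, hz]
    obtain ⟨S', hS', h4⟩ := fin_cover (J := J) (P := P₁) (U := V) _ (fun V z => z = 0)
      (fun i => (inj_iff f).1 hf' (op V) _ (h3 i))
    refine J.superset_covering (fun W k hk => ?_) hS'
    change tres M P₁ k.op (tres M P₁ g.op (∑ i, m i ⊗ₜ n i)) = tres M P₁ k.op 0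
    have h5 : ∀ i, res P₁ k.op (res P₁ g.op (n i)) = ∑ j, rres R₀ k.op (rres R₀ g.op (a i j)) • res P₁ k.op (z j) := by
      intro i
      have := h4 W k hk i
      rw [map_sub, sub_eq_zero, map_sum] at this
      rw [this]
      exact Finset.sum_congr rfl fun j _ => res_smul _ _ _ _
    rw [map_zero, map_sum, map_sum]
    simp only [tres_tmul, h5, TensorProduct.tmul_sum, TensorProduct.tmul_smul]
    rw [Finset.sum_comm]
    refine Finset.sum_eq_zero fun j _ => ?_
    simp only [← TensorProduct.smul_tmul, ← TensorProduct.tmul_smul]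
    simp only [← res_smul, ← TensorProduct.sum_tmul, ← map_sum, h2, map_zero, TensorProduct.zero_tmul]
  refine ⟨Sieve.bind S fun V g _ => Presheaf.equalizerSieve
    (F := (M ⊗ P₁).presheaf) (X := op V) (tres M P₁ g.op (∑ i, m i ⊗ₜ n i)) (0 : Tens M P₁ (op V)), 
    J.bind_covering hS fun V g hg => key V g hg, ?_⟩
  rintro W k ⟨V, k', g, hg, hk, rfl⟩
  have : tres M P₁ k'.op (tres M P₁ g.op (∑ i, m i ⊗ₜ n i)) = tres M P₁ k'.op 0 := hk
  rw [map_zero] at this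
  rw [← this]
  exact res_comp (M ⊗ P₁) g.op k'.op _
end

section lf
variable {R₀ : Cᵒᵖ ⥤ CommRingCat.{u}}

/-- Finite families of sections are locally combinations of linearly independent sections -/
def LocFin (J : GrothendieckTopology C) (M : PMod R₀) : Prop :=
  ∀ (U : C) (l : ℕ) (m : Fin l → M.obj (op U)), ∃ S ∈ J U, ∀ V (g : V ⟶ U), S g →
    ∃ (k : ℕ) (e : Fin k → M.obj (op V)) (c : Fin l → Fin k → (R₀ ⋙ forget₂ CommRingCat.{u} RingCat.{u}).obj (op V)),
      LinearIndependent ((R₀ ⋙ forget₂ CommRingCat.{u} RingCat.{u}).obj (op V)) e ∧ 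
      ∀ i, res M g.op (m i) = ∑ s, c i s • e s

theorem whiskerLeft_locallyInjective_of_locFin (M : PMod R₀) (hM : LocFin J M) {P₁ P₂ : PMod R₀} (f : P₁ ⟶ P₂)
    (hf : ∀ U, Function.Injective (f.app U).hom) :
    PresheafOfModules.IsLocallyInjective J (M ◁ f) := by
  refine tens_inj_aux M f fun U x hx => ?_
  obtain ⟨l, k, m, n, a, y, rfl, h1, h2⟩ := exists_relations (f.app U).hom x hx
  obtain ⟨S, hS, h⟩ := hM U.unop l m
  refine ⟨S, hS, fun V g hg => ?_⟩
  obtain ⟨r, e, c, he, h3⟩ := h V g hg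
  have h4 : ∀ (j : Fin k) (s : Fin r), ∑ i, rres R₀ g.op (a i j) * c i s = 0 := by
    intro j
    have h5 : ∑ s, (∑ i, rres R₀ g.op (a i j) * c i s) • e s = 0 := by
      have := congrArg (res M g.op) (h2 j)
      rw [map_zero, map_sum] at this
      rw [← this]
      simp only [res_smul, Finset.sum_smul, mul_smul]
      rw [Finset.sum_comm]
      refine Finset.sum_congr rfl fun i _ => ?_
      rw [← Finset.smul_sum]
      exact congrArg _ (h3 i).symm
    exact Fintype.linearIndependent_iff.1 he _ h5
  have h6 : ∀ s, ∑ i, c i s • res P₁ g.op (n i) = 0 := by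
    intro s
    apply hf (op V)
    rw [map_zero, map_sum]
    simp only [map_smul, res_app, h1]
    simp only [map_sum, res_smul, Finset.smul_sum, smul_smul]
    rw [Finset.sum_comm]
    refine Finset.sum_eq_zero fun j _ => ?_
    rw [← Finset.sum_smul]
    have := h4 j s
    simp only [mul_comm (c _ s)]
    rw [this, zero_smul]
  rw [map_sum]
  simp only [tres_tmul]
  have h7 : ∀ i, res M g.op (m i) ⊗ₜ[(R₀ ⋙ forget₂ CommRingCat.{u} RingCat.{u}).obj (op V)] res P₁ g.op (n i) = ∑ s, e s ⊗ₜ (c i s • res P₁ g.op (n i)) := by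
    intro i
    refine (congrArg (fun z => z ⊗ₜ[(R₀ ⋙ forget₂ CommRingCat.{u} RingCat.{u}).obj (op V)] res P₁ g.op (n i)) (h3 i)).trans ?_
    simp only [TensorProduct.sum_tmul, TensorProduct.smul_tmul]
  refine (Finset.sum_congr rfl fun i _ => h7 i).trans ?_
  rw [Finset.sum_comm]
  refine Finset.sum_eq_zero fun s _ => ?_
  rw [← TensorProduct.tmul_sum, h6, TensorProduct.tmul_zero]

end lf

section sheaf

section gen
variable (R : Sheaf J RingCat.{u})
abbrev sheafif0 : PresheafOfModules.{u} R.obj ⥤ SheafOfModules.{u} R := PresheafOfModules.sheafification (𝟙 R.obj)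
def adj0 : sheafif0 R ⊣ SheafOfModules.forget R := PresheafOfModules.sheafificationAdjunction (𝟙 R.obj)
theorem unit_loc0 (P : PresheafOfModules.{u} R.obj) : PresheafOfModules.IsLocallyInjective J ((adj0 R).unit.app P) ∧
  PresheafOfModules.IsLocallySurjective J ((adj0 R).unit.app P) := by
  have h : (PresheafOfModules.toPresheaf _).map ((adj0 R).unit.app P) =
      CategoryTheory.toSheafify J P.presheaf := rfl
  constructor
  · change Presheaf.IsLocallyInjective J _
    rw [h]
    exact (J.W_toSheafify P.presheaf).isLocallyInjective
  · change Presheaf.IsLocallySurjective J _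
    rw [h]
    exact (J.W_toSheafify P.presheaf).isLocallySurjective

theorem sheafif_isIso0 {P Q : PresheafOfModules.{u} R.obj} (f : P ⟶ Q) [PresheafOfModules.IsLocallyInjective J f] [PresheafOfModules.IsLocallySurjective J f] : IsIso ((sheafif0 R).map f) := by
  have : IsIso ((presheafToSheaf J AddCommGrpCat.{u}).map ((PresheafOfModules.toPresheaf _).map f)) := by
    have := J.W_of_isLocallyBijective ((PresheafOfModules.toPresheaf _).map f)
    rwa [GrothendieckTopology.W_iff] at this
  have : IsIso ((SheafOfModules.toSheaf R).map ((sheafif0 R).map f)) := this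
  exact isIso_of_reflects_iso _ (SheafOfModules.toSheaf R)

theorem sheafif_mono0 {P Q : PresheafOfModules.{u} R.obj} (f : P ⟶ Q) [PresheafOfModules.IsLocallyInjective J f] : Mono ((sheafif0 R).map f) := by
  have : Mono ((presheafToSheaf J AddCommGrpCat.{u}).map ((PresheafOfModules.toPresheaf _).map f)) := by
    have := (Presheaf.isLocallyInjective_presheafToSheaf_map_iff (J := J) (((PresheafOfModules.toPresheaf _).map f))).2 inferInstance
    exact Sheaf.mono_of_isLocallyInjective _
  have : Mono ((SheafOfModules.toSheaf R).map ((sheafif0 R).map f)) := this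
  exact (SheafOfModules.toSheaf R).mono_of_mono_map this

end gen
variable (O : Sheaf J CommRingCat.{u})

/-- A sheaf of commutative rings, regarded as a sheaf of rings. -/
abbrev ringSheaf : Sheaf J RingCat.{u} := (sheafCompose J (forget₂ CommRingCat.{u} RingCat.{u})).obj O


/-- Sheaves of `O`-modules. -/
abbrev ModSheaf := SheafOfModules.{u} (ringSheaf O)

/-- Sheafification of presheaves of `O`-modules. -/
def sheafif : PMod O.obj ⥤ ModSheaf O := sheafif0 (ringSheaf O)
/-- The inclusion of sheaves into presheaves of `O`-modules. -/
def incl : ModSheaf O ⥤ PMod O.obj := SheafOfModules.forget _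
/-- Sheafification is left adjoint to the inclusion. -/
def adj : sheafif O ⊣ incl O := adj0 (ringSheaf O)

/-- The functor `P ↦` sheafification of the presheaf tensor product `M ⊗ P`. -/
def preTens (M : PMod O.obj) : PMod O.obj ⥤ ModSheaf O := tensorLeft M ⋙ sheafif O
/-- The functor `M ⊗_O -` on sheaves of `O`-modules: `M ⊗_O N` is the sheafification of the
presheaf `U ↦ M(U) ⊗_{O(U)} N(U)`. -/
def tensorFunctor (M : ModSheaf O) : ModSheaf O ⥤ ModSheaf O := incl O ⋙ tensorLeft ((incl O).obj M) ⋙ sheafif O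

theorem unit_loc (P : PMod O.obj) : PresheafOfModules.IsLocallyInjective J ((adj O).unit.app P) ∧
  PresheafOfModules.IsLocallySurjective J ((adj O).unit.app P) := unit_loc0 (ringSheaf O) P

theorem sheafif_isIso {P Q : PMod O.obj} (f : P ⟶ Q) [PresheafOfModules.IsLocallyInjective J f] [PresheafOfModules.IsLocallySurjective J f] : IsIso ((sheafif O).map f) :=
  @sheafif_isIso0 _ _ _ (ringSheaf O) P Q f ‹_› ‹_›

theorem sheafif_mono {P Q : PMod O.obj} (f : P ⟶ Q) [PresheafOfModules.IsLocallyInjective J f] : Mono ((sheafif O).map f) := 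
  @sheafif_mono0 _ _ _ (ringSheaf O) P Q f ‹_›

instance : (incl O).Additive := inferInstanceAs (SheafOfModules.forget _).Additive
instance : (incl O).IsRightAdjoint := (adj O).isRightAdjoint
instance : (sheafif O).IsLeftAdjoint := (adj O).isLeftAdjoint
instance : (incl O).Full := inferInstanceAs (SheafOfModules.forget _).Full
instance : (incl O).Faithful := inferInstanceAs (SheafOfModules.forget _).Faithful
instance : (sheafif O).Additive := (adj O).left_adjoint_additive
instance (M : PMod O.obj) : (tensorLeft M).Additive where
  map_add {P Q f g} := by
    ext U x
    exact congrArg (fun k => k x) (LinearMap.lTensor_add (M.obj U) (f.app U).hom (g.app U).hom)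
instance tensorFunctor_additive (M : ModSheaf O) : (tensorFunctor O M).Additive := by unfold tensorFunctor; infer_instance

/-- `(M ⊗ P)^# ≅ (M ⊗ P^#)^#`. -/
def preTensIso (M : PMod O.obj) : preTens O M ≅ sheafif O ⋙ incl O ⋙ preTens O M := 
  have (P : PMod O.obj) : IsIso ((Functor.whiskerRight (adj O).unit (preTens O M)).app P) := by
    have := (unit_loc O P).1
    have := (unit_loc O P).2
    have := whiskerLeft_locallySurjective M ((adj O).unit.app P) (J := J)
    have := whiskerLeft_locallyInjective M ((adj O).unit.app P) (J := J)
    exact sheafif_isIso O (M ◁ (adj O).unit.app P)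
  have := NatIso.isIso_of_isIso_app (Functor.whiskerRight (adj O).unit (preTens O M))
  asIso (Functor.whiskerRight (adj O).unit (preTens O M))

instance (M : PMod O.obj) : PreservesFiniteColimits (preTens O M) := by
  unfold preTens
  infer_instance


instance tensorFunctor_preservesFiniteColimits (M : ModSheaf O) : PreservesFiniteColimits (tensorFunctor O M) where
  preservesFiniteColimits K _ _ := by
    constructor
    intro D
    have : IsIso (adj O).counit := inferInstance
    have e : sheafif O ⋙ tensorFunctor O M ≅ preTens O ((incl O).obj M) := (preTensIso O ((incl O).obj M)).symm
    have : PreservesColimit (D ⋙ incl O) (sheafif O ⋙ tensorFunctor O M) := 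
      preservesColimit_of_natIso _ e.symm
    have : PreservesColimit ((D ⋙ incl O) ⋙ sheafif O) (tensorFunctor O M) := 
      preservesColimit_of_preserves_colimit_cocone 
        (isColimitOfPreserves (sheafif O) (colimit.isColimit (D ⋙ incl O)))
        (isColimitOfPreserves (sheafif O ⋙ tensorFunctor O M) (colimit.isColimit (D ⋙ incl O)))
    have : PreservesColimit (D ⋙ incl O ⋙ sheafif O) (tensorFunctor O M) := this
    exact preservesColimit_of_iso_diagram (tensorFunctor O M) (Functor.isoWhiskerLeft D (asIso (adj O).counit))

theorem tensor_preservesFiniteLimits (M : ModSheaf O) (hM : LocFin J ((incl O).obj M)) : PreservesFiniteLimits (tensorFunctor O M) := by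
  have h1 : ∀ {P Q : ModSheaf O} (f : P ⟶ Q) [Mono f], Mono ((tensorFunctor O M).map f) := by
    intro P Q f _
    have : ∀ U, Function.Injective (((incl O).map f).app U).hom := by
      intro U
      have : Mono ((SheafOfModules.evaluation (ringSheaf O) U).map f) := inferInstance
      exact (ModuleCat.mono_iff_injective _).1 this
    exact @sheafif_mono _ _ _ O _ _ _ (whiskerLeft_locallyInjective_of_locFin (J := J) _ hM ((incl O).map f) this)
  rw [Functor.preservesFiniteLimits_iff_forall_exact_map_and_mono]
  intro S hS
  have := hS.mono_f
  have := hS.epi_g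
  exact ⟨((Functor.preservesFiniteColimits_iff_forall_exact_map_and_epi (tensorFunctor O M)).1 inferInstance S hS).1, h1 S.f⟩

end sheaf

section free
variable {D : Type u} [SmallCategory D] {K : GrothendieckTopology D} (R : Sheaf K RingCat.{u})

abbrev sec {R : Sheaf K RingCat.{u}} (M : SheafOfModules.{u} R) (U : Dᵒᵖ) : Type u := M.val.obj U

def pfree (I : Type u) : PresheafOfModules.{u} R.obj := PresheafOfModules.freeObj ((Functor.const _).obj I)

def pfreeDesc {I : Type u} {P : PresheafOfModules.{u} R.obj} (s : I → P.sections) : pfree R I ⟶ P :=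
  PresheafOfModules.freeObjDesc
    { app := fun U => ↾(fun i => (s i).1 U)
      naturality := fun U V g => by
        ext i
        exact ((s i).2 g).symm }

def pfreeSec {I : Type u} (i : I) : (pfree R I).sections :=
  PresheafOfModules.sectionsMk (fun U => ModuleCat.freeMk (R := R.obj.obj U) (i : I)) (by
    intro U V g
    exact ModuleCat.freeDesc_apply _ _)

theorem pfreeDesc_sec {I : Type u} {P : PresheafOfModules.{u} R.obj} (s : I → P.sections) (i : I) :
    PresheafOfModules.sectionsMap (pfreeDesc R s) (pfreeSec R i) = s i := by
  apply Subtype.ext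
  funext U
  exact ModuleCat.freeDesc_apply _ _

theorem pfree_surj (I : Type u) : 
    PresheafOfModules.IsLocallySurjective K (pfreeDesc R (fun i : I => 
      (SheafOfModules.freeSection (R := R) i : (SheafOfModules.free (R := R) I).val.sections))) := by
  set F := SheafOfModules.free (R := R) I
  let p : pfree R I ⟶ F.val := pfreeDesc R (fun i : I => SheafOfModules.freeSection (R := R) i)
  change PresheafOfModules.IsLocallySurjective K p
  let η := (adj0 R).unit.app (pfree R I)
  let p' : (sheafif0 R).obj (pfree R I) ⟶ F := ((adj0 R).homEquiv _ _).symm p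
  have hp : η ≫ p'.val = p := by
    have := ((adj0 R).homEquiv (pfree R I) F).apply_symm_apply p
    rwa [Adjunction.homEquiv_unit] at this
  let q : F ⟶ (sheafif0 R).obj (pfree R I) := (SheafOfModules.freeHomEquiv _).symm
    (fun i => PresheafOfModules.sectionsMap η (pfreeSec R i))
  have hq : q ≫ p' = 𝟙 F := by
    apply (SheafOfModules.freeHomEquiv F).injective
    funext i
    rw [SheafOfModules.freeHomEquiv_comp_apply, Equiv.apply_symm_apply]
    have : SheafOfModules.sectionsMap p' (PresheafOfModules.sectionsMap η (pfreeSec R i)) = 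
      PresheafOfModules.sectionsMap (η ≫ p'.val) (pfreeSec R i) := rfl
    rw [this, hp]
    exact pfreeDesc_sec R _ i
  have h1 := (unit_loc0 R (pfree R I)).2
  refine ⟨fun {U} s => ?_⟩
  refine K.superset_covering ?_ (h1.imageSieve_mem (U := U) ((q.val.app (op U)).hom s))
  rintro V g ⟨t, ht⟩
  refine ⟨t, ?_⟩
  have e1 : (p.app (op V)).hom t = (p'.val.app (op V)).hom ((η.app (op V)).hom t) := by
    rw [← hp]; rfl
  refine e1.trans ?_
  refine (congrArg (p'.val.app (op V)).hom ht).trans ?_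
  refine (PresheafOfModules.naturality_apply p'.val g.op _).trans ?_
  have e2 : (p'.val.app (op U)).hom ((q.val.app (op U)).hom s) = s := by
    have := congrArg (fun k : F ⟶ F => (k.val.app (op U)).hom s) hq
    exact this
  exact congrArg (F.val.map g.op).hom e2


def ev {R : Sheaf K RingCat.{u}} {M : SheafOfModules.{u} R} (s : M.sections) (U : Dᵒᵖ) : M.val.obj U := s.1 U

theorem ev_map {R : Sheaf K RingCat.{u}} {M N : SheafOfModules.{u} R} (f : M ⟶ N) (s : M.sections) (U : Dᵒᵖ) :
    (f.val.app U).hom (ev s U) = ev (SheafOfModules.sectionsMap f s) U := rfl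

theorem free_lin (I : Type u) (U : Dᵒᵖ) : LinearIndependent (R.obj.obj U)
    (fun i : I => ev (SheafOfModules.freeSection (R := R) i) U) := by
  classical
  rw [linearIndependent_iff']
  intro s g hg i hi
  let π : SheafOfModules.free (R := R) I ⟶ SheafOfModules.unit R := 
    (SheafOfModules.freeHomEquiv _).symm (fun j => (SheafOfModules.unit R).unitHomEquiv (if i = j then 𝟙 _ else 0))
  have hπ : ∀ j, (π.val.app U).hom (ev (SheafOfModules.freeSection (R := R) j) U) = (if i = j then (1 : R.obj.obj U) else 0) := by
    intro j
    rw [ev_map, SheafOfModules.sectionsMap_freeHomEquiv_symm_freeSection]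
    split_ifs <;> rfl
  have := congrArg (π.val.app U).hom hg
  rw [map_zero, map_sum] at this
  simp only [map_smul, hπ] at this
  have h2 : ∑ x ∈ s, g x • (if i = x then (1 : R.obj.obj U) else 0) = 0 := this
  simpa [hi] using h2

def fm {I : Type u} (i : I) (U : Dᵒᵖ) : (pfree R I).obj U := ModuleCat.freeMk (R := R.obj.obj U) i

theorem pfree_span (I : Type u) (U : Dᵒᵖ) (x : (pfree R I).obj U) :
    x ∈ Submodule.span (R.obj.obj U) (Set.range fun i : I => fm R i U) := by
  have h : ∀ y : I →₀ R.obj.obj U, (show (pfree R I).obj U from y) ∈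
      Submodule.span (R.obj.obj U) (Set.range fun i : I => fm R i U) := by
    intro y
    induction y using Finsupp.induction_linear with
    | zero => exact Submodule.zero_mem _
    | add f g hf hg => exact Submodule.add_mem _ hf hg
    | single i r =>
      have : (Finsupp.single i r : I →₀ R.obj.obj U) = r • Finsupp.single i 1 := by simp
      rw [this]
      exact Submodule.smul_mem _ r (Submodule.subset_span ⟨i, rfl⟩)
  exact h x

def ores (M : SheafOfModules.{u} R) {U V : Dᵒᵖ} (g : U ⟶ V) (m : M.val.obj U) : M.val.obj V := (M.val.map g).hom m

/-- For a sheaf isomorphic to a free one. -/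
theorem free_local {M : SheafOfModules.{u} R} {I : Type u} (e : SheafOfModules.free I ≅ M) (U : D)
    (m : M.val.obj (op U)) : ∃ S ∈ K U, ∀ V (g : V ⟶ U), S g → 
      ores R M g.op m ∈ Submodule.span (R.obj.obj (op V))
        (Set.range fun i : I => ev (SheafOfModules.freeHomEquiv M e.hom i) (op V)) := by
  have h := (pfree_surj R I).imageSieve_mem (U := U) ((e.inv.val.app (op U)).hom m)
  refine ⟨_, h, ?_⟩
  rintro V g ⟨t, ht⟩
  let φ := (e.hom.val.app (op V)).hom ∘ₗ ((pfreeDesc R (fun i : I => 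
      (SheafOfModules.freeSection (R := R) i : (SheafOfModules.free (R := R) I).val.sections))).app (op V)).hom
  have h1 : φ t = ores R M g.op m := by
    refine (congrArg (e.hom.val.app (op V)).hom ht).trans ?_
    refine (PresheafOfModules.naturality_apply e.hom.val g.op _).trans ?_
    have e2 : (e.hom.val.app (op U)).hom ((e.inv.val.app (op U)).hom m) = m := 
      congrArg (fun k : M ⟶ M => (k.val.app (op U)).hom m) e.inv_hom_id
    exact congrArg (M.val.map g.op).hom e2
  rw [← h1]
  have h2 := Submodule.mem_map_of_mem (f := φ) (pfree_span R I (op V) t)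
  rw [LinearMap.map_span, ← Set.range_comp] at h2
  refine Submodule.span_mono ?_ h2
  rintro _ ⟨i, rfl⟩
  refine ⟨i, ?_⟩
  exact (congrArg (fun z => (e.hom.val.app (op V)).hom z) 
    (congrArg (fun z : (SheafOfModules.free (R := R) I).sections => z.1 (op V)) (pfreeDesc_sec R (P := (SheafOfModules.free (R := R) I).val) (fun i : I => SheafOfModules.freeSection (R := R) i) i))).symm

theorem free_lin' {M : SheafOfModules.{u} R} {I : Type u} (e : SheafOfModules.free I ≅ M) (U : Dᵒᵖ) :
    LinearIndependent (R.obj.obj U) (fun i : I => ev (SheafOfModules.freeHomEquiv M e.hom i) U) := by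
  refine (free_lin R I U).map' (e.hom.val.app U).hom (LinearMap.ker_eq_bot.2 ?_)
  have : Mono ((SheafOfModules.evaluation R U).map e.hom) := inferInstance
  exact (ModuleCat.mono_iff_injective _).1 this

end free

theorem fin_inter {l : ℕ} {U : C} (S : Fin l → Sieve U) (hS : ∀ i, S i ∈ J U) :
    ∃ T ∈ J U, ∀ i, T ≤ S i := by
  induction l with
  | zero => exact ⟨⊤, J.top_mem U, fun j => j.elim0⟩
  | succ l ih =>
    obtain ⟨T, hT, h⟩ := ih (fun i => S i.succ) (fun i => hS i.succ)
    exact ⟨T ⊓ S 0, J.intersection_covering hT (hS 0),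
      Fin.cases inf_le_right (fun i => inf_le_left.trans (h i))⟩

theorem comb_of_span {A M I : Type*} [Ring A] [AddCommGroup M] [Module A M] (b : I → M) (hb : LinearIndependent A b)
    {l : ℕ} (x : Fin l → M) (hx : ∀ i, x i ∈ Submodule.span A (Set.range b)) :
    ∃ (k : ℕ) (e : Fin k → M) (c : Fin l → Fin k → A), LinearIndependent A e ∧ ∀ i, x i = ∑ s, c i s • e s := by
  classical
  choose f hf using fun i => (Finsupp.mem_span_range_iff_exists_finsupp.1 (hx i))
  let T : Finset I := Finset.univ.biUnion fun i => (f i).support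
  let q := T.equivFin.symm
  refine ⟨T.card, fun s => b (q s), fun i s => f i (q s), ?_, fun i => ?_⟩
  · exact hb.comp _ (Subtype.val_injective.comp q.injective)
  · rw [← hf i, Equiv.sum_comp q (fun s : T => f i s • b s), Finset.sum_coe_sort T (fun s => f i s • b s)]
    refine Finset.sum_subset (fun z hz => Finset.mem_biUnion.2 ⟨i, Finset.mem_univ _, hz⟩) ?_
    intro z _ hz
    simp [Finsupp.notMem_support_iff.1 hz]

section
variable (O : Sheaf J CommRingCat.{u})

theorem locFin_of_locallyFree (M : ModSheaf O) [hM : M.IsLocallyFree] : LocFin J ((incl O).obj M) := by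
  obtain ⟨q, hq⟩ := hM.exists_isLocallyFreeData
  intro U l m
  have h0 := q.coversTop U
  have key : ∀ V (g : V ⟶ U), Sieve.ofObjects q.X U g → ∃ S ∈ J V, ∀ W (k : W ⟶ V), S k → 
    ∃ (r : ℕ) (e : Fin r → ((incl O).obj M).obj (op W)) (c : Fin l → Fin r → (O.obj ⋙ forget₂ CommRingCat.{u} RingCat.{u}).obj (op W)),
      LinearIndependent ((O.obj ⋙ forget₂ CommRingCat.{u} RingCat.{u}).obj (op W)) e ∧ 
      ∀ i, res ((incl O).obj M) (k ≫ g).op (m i) = ∑ s, c i s • e s := by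
    intro V g hg
    obtain ⟨i, ⟨p⟩⟩ := (Sieve.mem_ofObjects_iff ..).1 hg
    let e := @asIso _ _ _ _ (q.generators i).π (hq.isIso i)
    let P : PMod O.obj := (incl O).obj M
    let Y : Over (q.X i) := Over.mk p
    let b : ∀ (W : C) (k : W ⟶ V), (q.generators i).I → P.obj (op W) := fun W k x =>
      ev (SheafOfModules.freeHomEquiv (M.over (q.X i)) e.hom x) (op (Over.mk (k ≫ p)))
    have hb : ∀ (W : C) (k : W ⟶ V), LinearIndependent ((O.obj ⋙ forget₂ CommRingCat.{u} RingCat.{u}).obj (op W)) (b W k) :=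
      fun W k => free_lin' _ e (op (Over.mk (k ≫ p)))
    have h1 : ∀ j : Fin l, ∃ S ∈ J V, ∀ W (k : W ⟶ V), S k →
      res P k.op (res P g.op (m j)) ∈ Submodule.span ((O.obj ⋙ forget₂ CommRingCat.{u} RingCat.{u}).obj (op W))
        (Set.range (b W k)) := by
      intro j
      obtain ⟨S, hS, h⟩ := free_local _ e Y (res P g.op (m j))
      refine ⟨Sieve.overEquiv Y S, hS, fun W k hk => ?_⟩
      rw [Sieve.overEquiv_iff] at hk
      exact h _ _ hk
    choose S hS h2 using h1
    obtain ⟨T, hT, hTS⟩ := fin_inter S hS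
    refine ⟨T, hT, fun W k hk => ?_⟩
    obtain ⟨r, e, c, he, h5⟩ := comb_of_span (b W k) (hb W k) (fun j => res P k.op (res P g.op (m j)))
      (fun j => h2 j W k (hTS j _ hk))
    exact ⟨r, e, c, he, fun j => (res_comp P g.op k.op (m j)).trans (h5 j)⟩
  choose! S hS h using key
  refine ⟨_, J.bind_covering h0 hS, ?_⟩
  rintro W _ ⟨V, k, g, hg, hk, rfl⟩
  exact h V g hg W k hk

end

end TensorProducts

section RingedSpaces

/-- The abelian category of sheaves of `𝒪_X`-modules on a ringed space. -/
abbrev OMod (X : RingedSpace.{u, u}) : Type (u + 1) := ModSheaf X.sheaf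

/-- The functor `M ⊗ -` on sheaves of `𝒪_X`-modules. -/
noncomputable abbrev OMod.tensor (X : RingedSpace.{u, u}) (M : OMod X) : OMod X ⥤ OMod X :=
  tensorFunctor X.sheaf M

instance (X : RingedSpace.{u, u}) (M : OMod X) : (OMod.tensor X M).Additive :=
  tensorFunctor_additive X.sheaf M

instance (X : RingedSpace.{u, u}) (M : OMod X) : PreservesFiniteColimits (OMod.tensor X M) :=
  tensorFunctor_preservesFiniteColimits X.sheaf M

/-- Tensoring with a locally free sheaf is exact. -/
instance (X : RingedSpace.{u, u}) (M : OMod X) [M.IsLocallyFree] :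
    PreservesFiniteLimits (OMod.tensor X M) :=
  tensor_preservesFiniteLimits X.sheaf M (locFin_of_locallyFree X.sheaf M)

/-- `Ext` groups of `𝒪_X`-modules. -/
instance OMod.hasExt (X : RingedSpace.{u, u}) : HasExt.{u + 1} (OMod X) := HasExt.standard _

variable {Q₀ : Type w₀} {Q₁ : Type w₁}

/-- The category of `M`-twisted `Q`-sheaves of `𝒪_X`-modules, that is, of sheaves of modules over
the `M`-twisted path algebra: `𝒪_X`-modules `V_i` for the vertices `i` together with morphisms
`φ_a : M_a ⊗ V_{ta} ⟶ V_{ha}` for the arrows `a`. -/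
abbrev QSheaf (X : RingedSpace.{u, u}) (h t : Q₁ → Q₀) (M : Q₁ → OMod X) :
    Type (max w₀ w₁ (u + 1)) :=
  TwistedRep h t fun a => OMod.tensor X (M a)

noncomputable instance QSheaf.abelian (X : RingedSpace.{u, u}) (h t : Q₁ → Q₀) (M : Q₁ → OMod X) :
    Abelian (QSheaf X h t M) := inferInstance

/-- `Ext` groups of twisted `Q`-sheaves. -/
instance QSheaf.hasExt (X : RingedSpace.{u, u}) (h t : Q₁ → Q₀) (M : Q₁ → OMod X) :
    HasExt.{max w₀ w₁ (u + 1)} (QSheaf X h t M) := HasExt.standard _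

end RingedSpaces

end QuiverSheaf

/-! The argument works for any abelian category `A` with exact countable coproducts and any exact
additive endofunctors `T a` that preserve them. For `𝒪_X`-modules and `T a = M_a ⊗ -`, local
freeness of `M_a` supplies the left exactness.

Every family `X` of objects generates a free representation `free h t T X`, the sum of `T_p(X_i)`
over all paths `p` starting at `i`. A representation `V` then has a two-term standard resolution `0
→ free (step V) → free V → V → 0`, where `step V` at a vertex `j` is the sum of `T_a(V_{ta})` over
the arrows `a` with head `j` (`std_shortExact`). The long exact sequence sought is the contravariant
`Ext(-, W)` sequence of this resolution, once its outer terms are computed.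

The computation is `Ext^n(free X, W) ≅ ∏ Ext^n(X_i, W_i)` (`extFree_bijective`). In degree `0` it is
the universal property of `free`. Higher degrees follow by dimension shifting, with neither
projectives nor injectives: every class of positive degree dies on some epimorphism onto its source
(`exists_epi_comp_eq_zero`), hence is an extension class times a class of one degree less, and
`free` is exact because the `T a` and the coproducts are.

It remains to see that the differential of the resolution induces `∂`, up to sign
(`extStep_extFree_stdD_comp`). For this the structure maps of representations must commute with
classes in `Ext^n`, not only with morphisms. They form a natural transformation between exact
functors, so the naturality in the functor of the induced maps on `Ext` is enough
(`mapExactFunctor_comp_mk₀_app`, `evalExt_φ`). -/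

/-! ### Effacing Ext classes; exact functors on Ext -/

namespace CategoryTheory.Abelian.Ext

variable {C : Type u} [Category.{v} C] [Abelian C]

/-- Every class of positive degree is effaced by an epimorphism onto its source. -/
theorem exists_epi_comp_eq_zero [HasExt.{e} C] {X Y : C} {n : ℕ} (x : Ext.{e} X Y (n + 1)) :
    ∃ (P : C) (p : P ⟶ X) (_ : Epi p), (mk₀ p).comp x (zero_add _) = 0 := by
  let := HasDerivedCategory.standard C
  let S := HomologicalComplex.single C (ComplexShape.up ℤ) 0
  let α : DerivedCategory.Q.obj (S.obj X) ⟶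
      DerivedCategory.Q.obj ((S.obj Y)⟦((n + 1 : ℕ) : ℤ)⟧) :=
    x.hom ≫ (DerivedCategory.Q.commShiftIso ((n + 1 : ℕ) : ℤ)).inv.app (S.obj Y)
  obtain ⟨K, s, hs, g, hα⟩ := DerivedCategory.right_fac α
  rw [DerivedCategory.isIso_Q_map_iff_quasiIso] at hs
  let i : S.obj (K.cycles 0) ⟶ K := HomologicalComplex.mkHomFromSingle (K.iCycles 0) (by simp)
  let p : K.cycles 0 ⟶ X := K.iCycles 0 ≫ s.f 0 ≫ (HomologicalComplex.singleObjXSelf _ 0 X).hom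
  have hip : i ≫ s = S.map p := by
    apply HomologicalComplex.from_single_hom_ext
    simp [i, S, p, HomologicalComplex.single_map_f_self]
  have hp : Epi p := by
    have h₁ := (S.obj X).isIso_homologyπ (-1) 0 (by simp) (by simp [S])
    have h₂ := (S.obj X).isIso_iCycles 0 1 (by simp) (by simp [S])
    have h₃ : Epi (HomologicalComplex.cyclesMap s 0 ≫ (S.obj X).homologyπ 0) := by
      rw [← HomologicalComplex.homologyπ_naturality]
      infer_instance
    have h₄ : Epi (HomologicalComplex.cyclesMap s 0) := by
      rw [← Category.comp_id (HomologicalComplex.cyclesMap s 0),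
        ← IsIso.hom_inv_id ((S.obj X).homologyπ 0), ← Category.assoc]
      infer_instance
    have h₅ : p = HomologicalComplex.cyclesMap s 0 ≫ (S.obj X).iCycles 0 ≫
        (HomologicalComplex.singleObjXSelf _ 0 X).hom := by
      simp [p, S]
    rw [h₅]
    exact epi_comp _ (_ ≫ (HomologicalComplex.singleObjXSelf (ComplexShape.up ℤ) 0 X).hom)
  -- Positivity of the degree enters here: `Y[n+1]` has only zero in degree `0`.
  have hig : i ≫ g = 0 := by
    apply HomologicalComplex.from_single_hom_ext
    apply (HomologicalComplex.isZero_single_obj_X (ComplexShape.up ℤ) 0 Y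
      (0 + ((n + 1 : ℕ) : ℤ)) (by omega)).eq_of_tgt
  have hpα : DerivedCategory.Q.map (S.map p) ≫ α = 0 := by
    rw [hα, ← hip, Functor.map_comp, Category.assoc, IsIso.hom_inv_id_assoc, ← Functor.map_comp,
      hig, Functor.map_zero]
  refine ⟨_, p, hp, ?_⟩
  ext
  rw [comp_hom, mk₀_hom, ShiftedHom.mk₀_comp, zero_hom]
  refine (cancel_mono ((DerivedCategory.Q.commShiftIso ((n + 1 : ℕ) : ℤ)).inv.app
    (S.obj Y))).1 ?_
  exact ((Category.assoc _ _ _).trans hpα).trans Limits.zero_comp.symm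

section

variable {D : Type*} [Category* D] [Abelian D] [HasExt.{e} C] [HasExt.{e'} D]
  {F G : C ⥤ D} [F.Additive] [PreservesFiniteLimits F] [PreservesFiniteColimits F]
  [G.Additive] [PreservesFiniteLimits G] [PreservesFiniteColimits G]

/-- The maps induced on `Ext` by exact functors are natural in the functor. -/
theorem mapExactFunctor_comp_mk₀_app (α : F ⟶ G) {X Y : C} {n : ℕ} (x : Ext.{e} X Y n) :
    (x.mapExactFunctor F : Ext.{e'} _ _ n).comp (mk₀ (α.app Y)) (add_zero n) =
      (mk₀ (α.app X)).comp (x.mapExactFunctor G) (zero_add n) := by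
  induction n generalizing X with
  | zero =>
    obtain ⟨f, rfl⟩ := (mk₀_bijective X Y).2 x
    simp [mapExactFunctor_mk₀]
  | succ n ih =>
    -- Dimension shift: `x` dies on `P`, so it is the extension class of `ker p → P → X` times some
    -- `y` of degree `n`. The extension class is handled by the morphism of short exact sequences
    -- that `α` induces, and `y` by induction.
    obtain ⟨P, p, hp, h⟩ := exists_epi_comp_eq_zero x
    let S := ShortComplex.mk _ _ (kernel.condition p)
    have hS : S.ShortExact := { exact := ShortComplex.exact_kernel p }
    obtain ⟨y, rfl⟩ := contravariant_sequence_exact₃ hS Y x h (add_comm 1 n)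
    have nat : (hS.extClass.mapExactFunctor F : Ext.{e'} _ _ 1).comp (mk₀ (α.app S.X₁))
        (add_zero 1) = (mk₀ (α.app S.X₃)).comp (hS.extClass.mapExactFunctor G) (zero_add 1) := by
      rw [mapExactFunctor_extClass, mapExactFunctor_extClass]
      exact (hS.map_of_exact F).extClass_naturality (hS.map_of_exact G) (S.mapNatTrans α)
    rw [mapExactFunctor_comp, mapExactFunctor_comp, comp_assoc_of_third_deg_zero, ih,
      ← comp_assoc_of_second_deg_zero, nat]
    exact comp_assoc _ _ _ (zero_add 1) (add_comm 1 n) (by omega)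

end

-- The same dimension shift reduces to morphisms and to extension classes; an exact functor sends
-- the class of a short exact sequence to the class of its image.
attribute [local instance] comp_preservesFiniteLimits comp_preservesFiniteColimits in
theorem mapExactFunctor_functor_comp {D E : Type*} [Category* D] [Abelian D] [Category* E]
    [Abelian E] [HasExt.{e} C] [HasExt.{e'} D] [HasExt.{w₀} E]
    (F : C ⥤ D) (G : D ⥤ E) [F.Additive] [PreservesFiniteLimits F] [PreservesFiniteColimits F]
    [G.Additive] [PreservesFiniteLimits G] [PreservesFiniteColimits G] {X Y : C} {n : ℕ}
    (x : Ext.{e} X Y n) : (x.mapExactFunctor (F ⋙ G) : Ext.{w₀} _ _ n) =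
      (x.mapExactFunctor F : Ext.{e'} _ _ n).mapExactFunctor G := by
  induction n generalizing X with
  | zero =>
    obtain ⟨f, rfl⟩ := (mk₀_bijective X Y).2 x
    rw [mapExactFunctor_mk₀, mapExactFunctor_mk₀, mapExactFunctor_mk₀]
    rfl
  | succ n ih =>
    obtain ⟨P, p, hp, h⟩ := exists_epi_comp_eq_zero x
    let S := ShortComplex.mk _ _ (kernel.condition p)
    have hS : S.ShortExact := { exact := ShortComplex.exact_kernel p }
    obtain ⟨y, rfl⟩ := contravariant_sequence_exact₃ hS Y x h (add_comm 1 n)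
    have key : (hS.extClass.mapExactFunctor (F ⋙ G) : Ext.{w₀} _ _ 1) =
        (hS.extClass.mapExactFunctor F : Ext.{e'} _ _ 1).mapExactFunctor G := by
      rw [mapExactFunctor_extClass, mapExactFunctor_extClass]
      exact (mapExactFunctor_extClass G (hS.map_of_exact F)).symm
    rw [mapExactFunctor_comp, mapExactFunctor_comp, mapExactFunctor_comp, ih, key]

end CategoryTheory.Abelian.Ext

/-! ### Coproducts of sheaves of modules -/

namespace PresheafOfModules

variable {C : Type u} [SmallCategory C] (R : Cᵒᵖ ⥤ RingCat.{u})

instance (J : Type) [Category.{0} J] : HasColimitsOfShape J (PresheafOfModules.{u} R) :=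
  have : HasColimitsOfSize.{0, 0} (PresheafOfModules.{u} R) := hasColimitsOfSizeShrink.{0, 0, u, u} _
  inferInstance

/-- Exactness of coproducts is inherited from presheaves of abelian groups along the forgetful
functor. -/
instance exactCoproducts (J : Type) :
    HasExactColimitsOfShape (Discrete J) (PresheafOfModules.{u} R) :=
  have : HasExactColimitsOfShape (Discrete J) AddCommGrpCat.{u} := inferInstance
  have : PreservesColimitsOfShape (Discrete J) (PresheafOfModules.toPresheaf R) := inferInstance
  HasExactColimitsOfShape.domain_of_functor (Discrete J) (PresheafOfModules.toPresheaf R)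

end PresheafOfModules

namespace QuiverSheaf

variable {C : Type u} [SmallCategory C] {J : GrothendieckTopology C}

/-- Coproducts of sheaves are sheafified coproducts of presheaves, and sheafification is exact. -/
theorem sheafOfModules_exactCoproducts (R : Sheaf J RingCat.{u}) (K : Type) :
    HasExactColimitsOfShape (Discrete K) (SheafOfModules.{u} R) :=
  (adj0 R).hasExactColimitsOfShape (Discrete K)

/-- After sheafification, `M ⊗ -` becomes the sheafified presheaf tensor product, which preserves
colimits. By the counit, every diagram of sheaves is the sheafification of a diagram of presheaves,
so this case suffices. -/
theorem tensorFunctor_preservesColimits (O : Sheaf J CommRingCat.{u}) (M : ModSheaf O) :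
    PreservesColimitsOfSize.{u, u} (tensorFunctor O M) where
  preservesColimitsOfShape {K _} := by
    constructor
    intro D
    have : PreservesColimitsOfSize.{u, u} (tensorLeft ((incl O).obj M)) := inferInstance
    have : PreservesColimitsOfSize.{u, u} (sheafif O) := (adj O).leftAdjoint_preservesColimits
    have : PreservesColimitsOfSize.{u, u} (preTens O ((incl O).obj M)) := by
      unfold preTens
      infer_instance
    have : IsIso (adj O).counit := inferInstance
    have e : sheafif O ⋙ tensorFunctor O M ≅ preTens O ((incl O).obj M) :=
      (preTensIso O ((incl O).obj M)).symm
    have : PreservesColimit (D ⋙ incl O) (sheafif O ⋙ tensorFunctor O M) :=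
      preservesColimit_of_natIso _ e.symm
    have : PreservesColimit ((D ⋙ incl O) ⋙ sheafif O) (tensorFunctor O M) :=
      preservesColimit_of_preserves_colimit_cocone
        (isColimitOfPreserves (sheafif O) (colimit.isColimit (D ⋙ incl O)))
        (isColimitOfPreserves (sheafif O ⋙ tensorFunctor O M) (colimit.isColimit (D ⋙ incl O)))
    have : PreservesColimit (D ⋙ incl O ⋙ sheafif O) (tensorFunctor O M) := this
    exact preservesColimit_of_iso_diagram (tensorFunctor O M)
      (Functor.isoWhiskerLeft D (asIso (adj O).counit))

end QuiverSheaf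

/-! ### Exactness of coproducts; functors preserving them -/

namespace CategoryTheory.ShortComplex

/-- Exact coproducts preserve short exact sequences. -/
theorem ShortExact.sigmaMap {A : Type u} [Category.{v} A] [Abelian A] {J : Type*}
    [HasColimitsOfShape (Discrete J) A] [HasExactColimitsOfShape (Discrete J) A]
    {S : J → ShortComplex A} (hS : ∀ j, (S j).ShortExact) :
    (ShortComplex.mk (Limits.Sigma.map fun j => (S j).f) (Limits.Sigma.map fun j => (S j).g)
      (by ext; simp)).ShortExact := by
  -- The family is a single short complex of functors, exact because it is so at each index; the
  -- exact functor `colim` then applies.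
  let F : ShortComplex (Discrete J ⥤ A) :=
    ShortComplex.mk (X₁ := Discrete.functor fun j => (S j).X₁)
      (X₂ := Discrete.functor fun j => (S j).X₂) (X₃ := Discrete.functor fun j => (S j).X₃)
      (Discrete.natTrans fun j => (S j.as).f) (Discrete.natTrans fun j => (S j.as).g)
      (by ext; simp)
  have hF : F.ShortExact := by
    have := fun j => (hS j).mono_f
    have := fun j => (hS j).epi_g
    have hm : Mono F.f := by
      have : ∀ j, Mono (F.f.app j) := fun j => (hS j.as).mono_f
      exact NatTrans.mono_of_mono_app _
    have he : Epi F.g := by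
      have : ∀ j, Epi (F.g.app j) := fun j => (hS j.as).epi_g
      exact NatTrans.epi_of_epi_app _
    refine { exact := ?_ }
    refine exact_of_f_is_kernel _ (evaluationJointlyReflectsLimits _ fun j => ?_)
    exact (KernelFork.isLimitMapConeEquiv _ ((evaluation (Discrete J) A).obj j)).symm
      (hS j.as).fIsKernel
  exact hF.map_of_exact colim

end CategoryTheory.ShortComplex

namespace CategoryTheory

variable {A : Type u} [Category.{v} A] [HasColimitsOfShape (Discrete ℕ) A]

/-- Morphisms from the image of a coproduct under a functor preserving it. -/
noncomputable def Functor.mapSigmaDesc (F : A ⥤ A)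
    [PreservesColimitsOfShape (Discrete ℕ) F] {X : ℕ → A} {Z : A} (f : ∀ n, F.obj (X n) ⟶ Z) :
    F.obj (∐ X) ⟶ Z :=
  CategoryTheory.inv (sigmaComparison F X) ≫ Limits.Sigma.desc f

theorem Functor.map_ι_mapSigmaDesc (F : A ⥤ A)
    [PreservesColimitsOfShape (Discrete ℕ) F] {X : ℕ → A} {Z : A} (f : ∀ n, F.obj (X n) ⟶ Z)
    (n : ℕ) : F.map (Sigma.ι X n) ≫ F.mapSigmaDesc f = f n := by
  rw [Functor.mapSigmaDesc, ← ι_comp_sigmaComparison, Category.assoc, IsIso.hom_inv_id_assoc,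
    Sigma.ι_desc]

theorem Functor.map_sigma_hom_ext (F : A ⥤ A)
    [PreservesColimitsOfShape (Discrete ℕ) F] {X : ℕ → A} {Z : A} {f g : F.obj (∐ X) ⟶ Z}
    (H : ∀ n, F.map (Sigma.ι X n) ≫ f = F.map (Sigma.ι X n) ≫ g) : f = g := by
  rw [← cancel_epi (sigmaComparison F X)]
  refine Sigma.hom_ext _ _ fun n => ?_
  rw [← Category.assoc, ← Category.assoc, ι_comp_sigmaComparison, H]

end CategoryTheory

/-! ### Free twisted representations -/

namespace QuiverSheaf.TwistedRep

variable {A : Type u} [Category.{v} A] [Abelian A] {Q₀ : Type w₀} {Q₁ : Type w₁} [Finite Q₁]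
  (h t : Q₁ → Q₀) (T : Q₁ → A ⥤ A)

/-- The family `j ↦ ⨁_{h a = j} T_a(X_{ta})`. -/
noncomputable def step (X : Q₀ → A) (j : Q₀) : A :=
  ∐ fun a : {a : Q₁ // h a = j} => (T a).obj (X (t a))

variable {X Y Z : Q₀ → A}

noncomputable def stepι (X : Q₀ → A) (a : Q₁) : (T a).obj (X (t a)) ⟶ step h t T X (h a) :=
  Sigma.ι (fun b : {b : Q₁ // h b = h a} => (T b).obj (X (t b))) ⟨a, rfl⟩

variable {h t T}

/-- With families over all vertices, `j` can be replaced by `h a`, and the criterion needs no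
transport along `h a = j`. -/
theorem step_hom_ext {f g : ∀ j, step h t T X j ⟶ Z j}
    (H : ∀ a, stepι h t T X a ≫ f (h a) = stepι h t T X a ≫ g (h a)) (j : Q₀) : f j = g j := by
  refine Sigma.hom_ext _ _ ?_
  rintro ⟨a, rfl⟩
  exact H a

noncomputable def stepDesc (f : ∀ a, (T a).obj (X (t a)) ⟶ Z (h a)) (j : Q₀) :
    step h t T X j ⟶ Z j :=
  Sigma.desc fun a => f a ≫ eqToHom (congrArg Z a.2)

theorem stepι_desc (f : ∀ a, (T a).obj (X (t a)) ⟶ Z (h a)) (a : Q₁) :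
    stepι h t T X a ≫ stepDesc f (h a) = f a :=
  (Sigma.ι_desc _ _).trans (by simp)

noncomputable def stepMap (g : ∀ i, X i ⟶ Y i) (j : Q₀) : step h t T X j ⟶ step h t T Y j :=
  Limits.Sigma.map fun a => (T a).map (g (t a))

theorem stepι_map (g : ∀ i, X i ⟶ Y i) (a : Q₁) :
    stepι h t T X a ≫ stepMap g (h a) = (T a).map (g (t a)) ≫ stepι h t T Y a :=
  Sigma.ι_map _ _

variable (h t T)

/-- The sum of `T_p(X_i)` over the paths `p` of length `n` from `i` to a given vertex. -/
noncomputable def level : ℕ → (Q₀ → A) → Q₀ → A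
  | 0, X => X
  | n + 1, X => level n (step h t T X)

/-- Appends `a` at the end of a path. Since `level` adds arrows at the start, the recursion leaves
the end alone and typechecks by unfolding `level`. -/
noncomputable def levelAct : ∀ (n : ℕ) (X : Q₀ → A) (a : Q₁),
    (T a).obj (level h t T n X (t a)) ⟶ level h t T (n + 1) X (h a)
  | 0, X, a => stepι h t T X a
  | n + 1, X, a => levelAct n (step h t T X) a

variable {h t T}

theorem level_hom_ext (n : ℕ) {X : Q₀ → A} {f g : ∀ j, level h t T (n + 1) X j ⟶ Z j}
    (H : ∀ a, levelAct h t T n X a ≫ f (h a) = levelAct h t T n X a ≫ g (h a)) (j : Q₀) :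
    f j = g j := by
  induction n generalizing X with
  | zero => exact step_hom_ext H j
  | succ n ih => exact ih (X := step h t T X) H

noncomputable def levelMap : ∀ (n : ℕ) {X Y : Q₀ → A} (_ : ∀ i, X i ⟶ Y i) (j : Q₀),
    level h t T n X j ⟶ level h t T n Y j
  | 0, _, _, g => g
  | n + 1, _, _, g => levelMap n (stepMap g)

theorem levelAct_map (n : ℕ) {X Y : Q₀ → A} (g : ∀ i, X i ⟶ Y i) (a : Q₁) :
    (T a).map (levelMap n g (t a)) ≫ levelAct h t T n Y a =
      levelAct h t T n X a ≫ levelMap (n + 1) g (h a) := by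
  induction n generalizing X Y with
  | zero => exact (stepι_map g a).symm
  | succ n ih => exact ih (stepMap g)

/-- Applies `f` at the start of a path and then the structure maps of `W` along its arrows. -/
noncomputable def levelLift (W : TwistedRep h t T) : ∀ (n : ℕ) {X : Q₀ → A}
    (_ : ∀ i, X i ⟶ W.obj i) (j : Q₀), level h t T n X j ⟶ W.obj j
  | 0, _, f => f
  | n + 1, _, f => levelLift W n (stepDesc fun a => (T a).map (f (t a)) ≫ W.φ a)

theorem levelAct_lift (W : TwistedRep h t T) (n : ℕ) {X : Q₀ → A} (f : ∀ i, X i ⟶ W.obj i)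
    (a : Q₁) : (T a).map (levelLift W n f (t a)) ≫ W.φ a =
      levelAct h t T n X a ≫ levelLift W (n + 1) f (h a) := by
  induction n generalizing X with
  | zero => exact (stepι_desc (fun a => (T a).map (f (t a)) ≫ W.φ a) a).symm
  | succ n ih => exact ih _

section Exact

variable [∀ a, (T a).Additive] [∀ a, PreservesFiniteLimits (T a)]
  [∀ a, PreservesFiniteColimits (T a)]

/-- Each `T a` is exact, and so are finite coproducts in an abelian category. -/
theorem stepMap_shortExact {S : Q₀ → ShortComplex A} (hS : ∀ j, (S j).ShortExact) :
    ∃ w : ∀ j, stepMap (h := h) (t := t) (T := T) (fun i => (S i).f) j ≫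
      stepMap (fun i => (S i).g) j = 0, ∀ j, (ShortComplex.mk _ _ (w j)).ShortExact := by
  have : HasFiniteBiproducts A := Abelian.hasFiniteBiproducts
  have := fun j => hasExactColimitsOfShape_discrete_finite A {a : Q₁ // h a = j}
  have := fun j => ShortComplex.ShortExact.sigmaMap
    (fun a : {a : Q₁ // h a = j} => (hS (t a)).map_of_exact (T a))
  refine ⟨fun j => step_hom_ext (f := fun j => stepMap (fun i => (S i).f) j ≫
    stepMap (fun i => (S i).g) j) (g := fun _ => 0) (fun a => ?_) j, this⟩
  rw [← Category.assoc, stepι_map, Category.assoc, stepι_map, ← Category.assoc,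
    ← Functor.map_comp, (S _).zero, Functor.map_zero, zero_comp, comp_zero]

theorem levelMap_shortExact (n : ℕ) {S : Q₀ → ShortComplex A} (hS : ∀ j, (S j).ShortExact) :
    ∃ w : ∀ j, levelMap (h := h) (t := t) (T := T) n (fun i => (S i).f) j ≫
      levelMap n (fun i => (S i).g) j = 0, ∀ j, (ShortComplex.mk _ _ (w j)).ShortExact := by
  induction n generalizing S with
  | zero => exact ⟨fun j => (S j).zero, hS⟩
  | succ n ih =>
    obtain ⟨w, hw⟩ := stepMap_shortExact (h := h) (t := t) (T := T) hS
    exact ih hw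

end Exact

section Free

variable [HasColimitsOfShape (Discrete ℕ) A] [∀ a, PreservesColimitsOfShape (Discrete ℕ) (T a)]

variable (h t T) in
/-- The free twisted representation on a family of objects. -/
noncomputable def free (X : Q₀ → A) : TwistedRep h t T where
  obj j := ∐ fun n : ℕ => level h t T n X j
  φ a := (T a).mapSigmaDesc fun n =>
    levelAct h t T n X a ≫ Sigma.ι (fun n => level h t T n X (h a)) (n + 1)

variable (h t T) in
noncomputable def freeι (X : Q₀ → A) (n : ℕ) (j : Q₀) :
    level h t T n X j ⟶ (free h t T X).obj j :=
  Sigma.ι (fun n => level h t T n X j) n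

theorem freeι_φ (X : Q₀ → A) (n : ℕ) (a : Q₁) :
    (T a).map (freeι h t T X n (t a)) ≫ (free h t T X).φ a =
      levelAct h t T n X a ≫ freeι h t T X (n + 1) (h a) :=
  (T a).map_ι_mapSigmaDesc _ n

theorem free_obj_hom_ext {Z : A} {j : Q₀} {f g : (free h t T X).obj j ⟶ Z}
    (H : ∀ n, freeι h t T X n j ≫ f = freeι h t T X n j ≫ g) : f = g :=
  Sigma.hom_ext _ _ H

theorem map_free_obj_hom_ext {Z : A} {a : Q₁} {j : Q₀} {f g : (T a).obj ((free h t T X).obj j) ⟶ Z}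
    (H : ∀ n, (T a).map (freeι h t T X n j) ≫ f = (T a).map (freeι h t T X n j) ≫ g) : f = g :=
  (T a).map_sigma_hom_ext H

noncomputable def freeObjDesc {Z : A} {j : Q₀} (f : ∀ n, level h t T n X j ⟶ Z) :
    (free h t T X).obj j ⟶ Z :=
  Sigma.desc f

theorem freeι_objDesc {Z : A} {j : Q₀} (f : ∀ n, level h t T n X j ⟶ Z) (n : ℕ) :
    freeι h t T X n j ≫ freeObjDesc f = f n :=
  Sigma.ι_desc _ _

/-- Morphisms out of a free representation, given on the levels. -/
noncomputable def freeDesc (X : Q₀ → A) (W : TwistedRep h t T)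
    (f : ∀ n j, level h t T n X j ⟶ W.obj j)
    (hf : ∀ n a, (T a).map (f n (t a)) ≫ W.φ a = levelAct h t T n X a ≫ f (n + 1) (h a)) :
    free h t T X ⟶ W where
  app j := freeObjDesc fun n => f n j
  comm a := map_free_obj_hom_ext fun n => by
    rw [← Category.assoc, ← Category.assoc, ← Functor.map_comp, freeι_objDesc, freeι_φ, hf,
      Category.assoc, freeι_objDesc]

theorem freeι_desc (W : TwistedRep h t T)
    (f : ∀ n j, level h t T n X j ⟶ W.obj j)
    (hf : ∀ n a, (T a).map (f n (t a)) ≫ W.φ a = levelAct h t T n X a ≫ f (n + 1) (h a))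
    (n : ℕ) (j : Q₀) : freeι h t T X n j ≫ (freeDesc X W f hf).app j = f n j :=
  freeι_objDesc _ _

noncomputable def freeUnit (X : Q₀ → A) (i : Q₀) : X i ⟶ (free h t T X).obj i :=
  freeι h t T X 0 i

/-- Level `0` generates: the structure maps carry the objects `T_a(level n)` jointly epimorphically
onto level `n + 1`. -/
theorem free_hom_ext {W : TwistedRep h t T} {f g : free h t T X ⟶ W}
    (H : ∀ i, freeUnit X i ≫ f.app i = freeUnit X i ≫ g.app i) : f = g := by
  have key : ∀ n j, freeι h t T X n j ≫ f.app j = freeι h t T X n j ≫ g.app j := by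
    intro n
    induction n with
    | zero => exact H
    | succ n ih =>
      refine level_hom_ext n fun a => ?_
      rw [← Category.assoc, ← Category.assoc, ← freeι_φ, Category.assoc, Category.assoc, ← f.comm,
        ← g.comm, ← Functor.map_comp_assoc, ← Functor.map_comp_assoc, ih]
  ext j
  exact free_obj_hom_ext fun n => key n j

noncomputable def freeLift {W : TwistedRep h t T} (f : ∀ i, X i ⟶ W.obj i) : free h t T X ⟶ W :=
  freeDesc X W (fun n => levelLift W n f) fun n => levelAct_lift W n f

theorem freeUnit_lift {W : TwistedRep h t T} (f : ∀ i, X i ⟶ W.obj i) (i : Q₀) :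
    freeUnit X i ≫ (freeLift f).app i = f i := by
  exact freeι_desc _ _ _ 0 i

noncomputable def freeMap (g : ∀ i, X i ⟶ Y i) : free h t T X ⟶ free h t T Y :=
  freeDesc X _ (fun n j => levelMap n g j ≫ freeι h t T Y n j) fun n a => by
    rw [Functor.map_comp_assoc, freeι_φ, ← Category.assoc, levelAct_map, Category.assoc]

theorem freeUnit_map (g : ∀ i, X i ⟶ Y i) (i : Q₀) :
    freeUnit X i ≫ (freeMap g : free h t T X ⟶ _).app i = g i ≫ freeUnit Y i :=
  freeι_desc _ _ _ 0 i

theorem freeMap_app (g : ∀ i, X i ⟶ Y i) (j : Q₀) :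
    (freeMap g : free h t T X ⟶ _).app j = Limits.Sigma.map fun n => levelMap n g j :=
  free_obj_hom_ext fun n =>
    (freeι_desc _ _ _ n j).trans (Sigma.ι_map (fun n => levelMap n g j) n).symm

section

variable [∀ a, (T a).Additive] [∀ a, PreservesFiniteColimits (T a)]

/-- The exact functors `eval` commute with homology and are jointly faithful, so they jointly detect
exactness, monos and epis. -/
theorem shortExact_of_eval {S : ShortComplex (TwistedRep h t T)}
    (hS : ∀ i, (S.map (eval h t T i)).ShortExact) : S.ShortExact where
  exact := by
    rw [ShortComplex.exact_iff_isZero_homology, IsZero.iff_id_eq_zero]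
    ext i
    exact (((S.map (eval h t T i)).exact_iff_isZero_homology.1 (hS i).exact).of_iso
      (S.mapHomologyIso (eval h t T i)).symm).eq_of_src _ _
  mono_f := ⟨fun f g H => by
    ext i
    have : Mono (S.f.app i) := (hS i).mono_f
    exact (cancel_mono (S.f.app i)).1 (congrArg (fun k => k.app i) H)⟩
  epi_g := ⟨fun f g H => by
    ext i
    have : Epi (S.g.app i) := (hS i).epi_g
    exact (cancel_epi (S.g.app i)).1 (congrArg (fun k => k.app i) H)⟩

theorem freeMap_comp_eq_zero {f : ∀ i, X i ⟶ Y i} {g : ∀ i, Y i ⟶ Z i}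
    (H : ∀ i, f i ≫ g i = 0) : (freeMap f : free h t T X ⟶ _) ≫ freeMap g = 0 := by
  refine free_hom_ext fun i => ?_
  rw [comp_app, ← Category.assoc, freeUnit_map, Category.assoc, freeUnit_map, ← Category.assoc,
    H, zero_comp, zero_app, comp_zero]

variable (h t T) in
/-- The free representations on a family of short complexes. -/
noncomputable abbrev freeShortComplex (S : Q₀ → ShortComplex A) :
    ShortComplex (TwistedRep h t T) :=
  ShortComplex.mk _ _ (freeMap_comp_eq_zero (h := h) (t := t) (T := T) fun i => (S i).zero)

theorem freeShortComplex_shortExact [HasExactColimitsOfShape (Discrete ℕ) A]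
    [∀ a, PreservesFiniteLimits (T a)] {S : Q₀ → ShortComplex A}
    (hS : ∀ i, (S i).ShortExact) : (freeShortComplex h t T S).ShortExact := by
  refine shortExact_of_eval fun j => ?_
  choose w hw using fun n => levelMap_shortExact (h := h) (t := t) (T := T) n hS
  have := ShortComplex.ShortExact.sigmaMap fun n => hw n j
  refine ShortComplex.shortExact_of_iso (ShortComplex.isoMk (Iso.refl _) (Iso.refl _) (Iso.refl _)
    ?_ ?_) this
  · exact (Category.id_comp _).trans ((freeMap_app _ j).trans (Category.comp_id _).symm)
  · exact (Category.id_comp _).trans ((freeMap_app _ j).trans (Category.comp_id _).symm)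

variable (h t T) in
/-- The inclusion of the positive levels. -/
noncomputable def freeSuccι (X : Q₀ → A) (n : ℕ) (j : Q₀) :
    level h t T n (step h t T X) j ⟶ (free h t T X).obj j :=
  freeι h t T X (n + 1) j

theorem freeSuccι_φ (X : Q₀ → A) (n : ℕ) (a : Q₁) :
    (T a).map (freeSuccι h t T X n (t a)) ≫ (free h t T X).φ a =
      levelAct h t T n (step h t T X) a ≫ freeSuccι h t T X (n + 1) (h a) :=
  freeι_φ X (n + 1) a

variable (h t T) in
/-- The inclusion of the first level. -/
noncomputable def freeStepι (X : Q₀ → A) (j : Q₀) :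
    step h t T X j ⟶ (free h t T X).obj j :=
  freeι h t T X 1 j

theorem stepι_freeStepι (X : Q₀ → A) (a : Q₁) :
    stepι h t T X a ≫ freeStepι h t T X (h a) =
      (T a).map (freeUnit X (t a)) ≫ (free h t T X).φ a :=
  (freeι_φ X 0 a).symm

/-! ### The standard resolution -/

variable (V : TwistedRep h t T)

/-- All structure maps of a representation at once. -/
noncomputable abbrev stepφ (j : Q₀) : step h t T V.obj j ⟶ V.obj j := stepDesc V.φ j

/-- The differential of the standard resolution of a representation. -/
noncomputable def stdD : free h t T (step h t T V.obj) ⟶ free h t T V.obj :=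
  freeDesc _ _
    -- The first arrow of a path is treated in two ways: kept, giving a path of length `n + 1`, or
    -- absorbed into `V` by the structure map, leaving length `n`.
    (fun n j => freeSuccι h t T V.obj n j - levelMap n V.stepφ j ≫ freeι h t T V.obj n j)
    (fun n a => by
      rw [Functor.map_sub, Preadditive.sub_comp, Preadditive.comp_sub, freeSuccι_φ,
        Functor.map_comp, Category.assoc, freeι_φ, ← Category.assoc, levelAct_map, Category.assoc])

theorem freeι_stdD (n : ℕ) (j : Q₀) : freeι h t T _ n j ≫ V.stdD.app j =
    freeSuccι h t T V.obj n j - levelMap n V.stepφ j ≫ freeι h t T V.obj n j :=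
  freeι_desc _ _ _ n j

theorem stepι_freeUnit_stdD (a : Q₁) :
    stepι h t T V.obj a ≫ freeUnit _ (h a) ≫ V.stdD.app (h a) =
      (T a).map (freeUnit V.obj (t a)) ≫ (free h t T V.obj).φ a - V.φ a ≫ freeUnit V.obj (h a) := by
  have : freeUnit (step h t T V.obj) (h a) ≫ V.stdD.app (h a) =
      freeStepι h t T V.obj (h a) - V.stepφ (h a) ≫ freeUnit V.obj (h a) :=
    V.freeι_stdD 0 (h a)
  rw [this, Preadditive.comp_sub, stepι_freeStepι, ← Category.assoc, stepι_desc]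

/-- The recursion is forced: `stdD` on level `n` is the inclusion of level `n + 1` minus a map
through level `n`, so a retraction `r` must satisfy `r (n + 1) = ι n + (absorb the first arrow, then
r n)`. The value on level `0` is free and taken to be `0`. -/
noncomputable def stdRetractionAux : ∀ (n : ℕ) (j : Q₀),
    level h t T n V.obj j ⟶ (free h t T (step h t T V.obj)).obj j
  | 0, _ => 0
  | n + 1, j => (freeι h t T (step h t T V.obj) n j + levelMap n V.stepφ j ≫ stdRetractionAux n j :
      level h t T n (step h t T V.obj) j ⟶ _)

/-- A retraction of the standard differential, compatible with no structure maps. -/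
noncomputable def stdRetraction (j : Q₀) :
    (free h t T V.obj).obj j ⟶ (free h t T (step h t T V.obj)).obj j :=
  freeObjDesc fun n => V.stdRetractionAux n j

theorem stdD_retraction (j : Q₀) : V.stdD.app j ≫ V.stdRetraction j = 𝟙 _ :=
  free_obj_hom_ext fun n => by
    have h₁ : freeSuccι h t T V.obj n j ≫ V.stdRetraction j =
        freeι h t T _ n j + levelMap n V.stepφ j ≫ V.stdRetractionAux n j := freeι_objDesc _ (n + 1)
    have h₂ : freeι h t T V.obj n j ≫ V.stdRetraction j = V.stdRetractionAux n j :=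
      freeι_objDesc _ n
    rw [← Category.assoc, freeι_stdD, Preadditive.sub_comp, h₁, Category.assoc, h₂,
      add_sub_cancel_right, Category.comp_id]

/-- The augmentation of the standard resolution. -/
noncomputable def stdπ : free h t T V.obj ⟶ V := freeLift fun i => 𝟙 (V.obj i)

theorem freeUnit_stdπ (i : Q₀) : freeUnit V.obj i ≫ V.stdπ.app i = 𝟙 _ := freeUnit_lift _ i

theorem stepι_freeUnit_stdD_comp {W : TwistedRep h t T} (f : free h t T V.obj ⟶ W) (a : Q₁) :
    stepι h t T V.obj a ≫ freeUnit _ (h a) ≫ (V.stdD ≫ f).app (h a) =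
      (T a).map (freeUnit V.obj (t a) ≫ f.app (t a)) ≫ W.φ a -
        V.φ a ≫ freeUnit V.obj (h a) ≫ f.app (h a) := by
  have := congrArg (· ≫ f.app (h a)) (V.stepι_freeUnit_stdD a)
  simp only [Preadditive.sub_comp, Category.assoc] at this
  rw [comp_app, this, Functor.map_comp, Category.assoc, f.comm]

/-- By freeness, `V.stdD ≫ f` need only be tested on the generators `T_a(V_{ta})`, where it is the
defect of `f` on level `0` from commuting with the structure maps. -/
theorem stdD_comp_eq_zero_iff {W : TwistedRep h t T} (f : free h t T V.obj ⟶ W) :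
    V.stdD ≫ f = 0 ↔ ∀ a, (T a).map (freeUnit V.obj (t a) ≫ f.app (t a)) ≫ W.φ a =
      V.φ a ≫ freeUnit V.obj (h a) ≫ f.app (h a) := by
  constructor
  · intro H a
    rw [← sub_eq_zero, ← stepι_freeUnit_stdD_comp, H]
    simp
  · intro H
    refine free_hom_ext fun j => ?_
    refine step_hom_ext
      (f := fun j => freeUnit (step h t T V.obj) j ≫ (V.stdD ≫ f).app j)
      (g := fun j => freeUnit (step h t T V.obj) j ≫ (0 : free h t T _ ⟶ W).app j) (fun a => ?_) j
    rw [stepι_freeUnit_stdD_comp, H, sub_self, zero_app, comp_zero, comp_zero]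

theorem stdD_π : V.stdD ≫ V.stdπ = 0 := by
  rw [stdD_comp_eq_zero_iff]
  intro a
  rw [freeUnit_stdπ, freeUnit_stdπ, CategoryTheory.Functor.map_id, Category.id_comp,
    Category.comp_id]

/-- The standard resolution of a representation by free ones. -/
noncomputable abbrev std : ShortComplex (TwistedRep h t T) := ShortComplex.mk _ _ V.stdD_π

/-- Vertexwise, a retraction of `stdD` gives the mono and the section `freeUnit` of `stdπ` gives the
epi. For exactness, a morphism from `free V` killing `stdD` is the same as a morphism of
representations from `V`, so `V` is the cokernel. -/
theorem std_shortExact : V.std.ShortExact where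
  mono_f := ⟨fun f g H => by
    ext j
    have := congrArg (fun k => k.app j ≫ V.stdRetraction j) H
    simpa only [comp_app, Category.assoc, stdD_retraction, Category.comp_id] using this⟩
  epi_g := ⟨fun f g H => by
    ext j
    have := congrArg (fun k => freeUnit V.obj j ≫ k.app j) H
    simpa only [comp_app, ← Category.assoc, freeUnit_stdπ, Category.id_comp] using this⟩
  exact := ShortComplex.exact_of_g_is_cokernel _ <| CokernelCofork.IsColimit.ofπ _ _
    (fun {W} f hf =>
      { app := fun i => freeUnit V.obj i ≫ f.app i
        comm := (V.stdD_comp_eq_zero_iff f).1 hf })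
    (fun f hf => free_hom_ext fun i => by
      rw [comp_app, ← Category.assoc, freeUnit_stdπ, Category.id_comp])
    (fun f hf m hm => by
      ext i
      have := congrArg (fun k => freeUnit V.obj i ≫ k.app i) hm
      rwa [comp_app, ← Category.assoc, freeUnit_stdπ, Category.id_comp] at this)

end

end Free

end QuiverSheaf.TwistedRep

/-! ### Ext out of free representations -/

namespace QuiverSheaf.TwistedRep

open Abelian

variable {A : Type u} [Category.{v} A] [Abelian A] {Q₀ : Type w₀} {Q₁ : Type w₁} [Finite Q₁]
  {h t : Q₁ → Q₀} {T : Q₁ → A ⥤ A} [∀ a, (T a).Additive] [∀ a, PreservesFiniteLimits (T a)]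
  [∀ a, PreservesFiniteColimits (T a)]
  [HasColimitsOfShape (Discrete ℕ) A] [∀ a, PreservesColimitsOfShape (Discrete ℕ) (T a)]
  [HasExt.{e} A] [HasExt.{e'} (TwistedRep h t T)]

/-- The map on `Ext` induced by the forgetful functor at a vertex. -/
noncomputable def evalExt {V W : TwistedRep h t T} {n : ℕ} (z : Ext.{e'} V W n) (i : Q₀) :
    Ext.{e} (V.obj i) (W.obj i) n :=
  z.mapExactFunctor (eval h t T i)

theorem evalExt_zero {V W : TwistedRep h t T} {n : ℕ} (i : Q₀) :
    evalExt.{v, u, w₀, w₁, e, e'} (0 : Ext.{e'} V W n) i = 0 :=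
  Ext.mapExactFunctor_zero _ _ _ _

theorem evalExt_add {V W : TwistedRep h t T} {n : ℕ} (x y : Ext.{e'} V W n) (i : Q₀) :
    evalExt.{v, u, w₀, w₁, e, e'} (x + y) i = evalExt x i + evalExt y i :=
  Ext.mapExactFunctor_add _ _ _ _ _ _

theorem evalExt_comp {U V W : TwistedRep h t T} {n m k : ℕ} (x : Ext.{e'} U V n)
    (y : Ext.{e'} V W m) (hk : n + m = k) (i : Q₀) :
    evalExt.{v, u, w₀, w₁, e, e'} (x.comp y hk) i = (evalExt x i).comp (evalExt y i) hk :=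
  Ext.mapExactFunctor_comp _ _ _ _

theorem evalExt_mk₀ {V W : TwistedRep h t T} (f : V ⟶ W) (i : Q₀) :
    evalExt.{v, u, w₀, w₁, e, e'} (Ext.mk₀ f) i = Ext.mk₀ (f.app i) :=
  Ext.mapExactFunctor_mk₀ _ _

variable (h t T) in
/-- The structure maps of twisted representations, as a natural transformation. -/
def φNatTrans (a : Q₁) : eval h t T (t a) ⋙ T a ⟶ eval h t T (h a) where
  app V := V.φ a
  naturality _ _ f := f.comm a

-- The extension to `Ext^n` of the commutation rule for morphisms of representations, obtained from
-- naturality of induced maps for `φNatTrans`.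
attribute [local instance] comp_preservesFiniteLimits comp_preservesFiniteColimits in
theorem evalExt_φ {V W : TwistedRep h t T} {n : ℕ} (z : Ext.{e'} V W n) (a : Q₁) :
    (Ext.mk₀ (V.φ a)).comp (evalExt.{v, u, w₀, w₁, e, e'} z (h a)) (zero_add n) =
      ((evalExt z (t a)).mapExactFunctor (T a)).comp (Ext.mk₀ (W.φ a)) (add_zero n) := by
  have nat : (z.mapExactFunctor (eval h t T (t a) ⋙ T a) : Ext.{e} _ _ n).comp
      (Ext.mk₀ (W.φ a)) (add_zero n) =
      (Ext.mk₀ (V.φ a)).comp (z.mapExactFunctor (eval h t T (h a))) (zero_add n) :=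
    Ext.mapExactFunctor_comp_mk₀_app (φNatTrans h t T a) z
  have comp : (z.mapExactFunctor (eval h t T (t a) ⋙ T a) : Ext.{e} _ _ n) =
      (evalExt.{v, u, w₀, w₁, e, e'} z (t a)).mapExactFunctor (T a) :=
    Ext.mapExactFunctor_functor_comp _ _ z
  rw [comp] at nat
  exact nat.symm

/-- The map `Ext^n(free X, W) ⟶ ∏ Ext^n(X_i, W_i)`. -/
noncomputable def extFree (X : Q₀ → A) (W : TwistedRep h t T) (n : ℕ) :
    Ext.{e'} (free h t T X) W n →+ ((i : Q₀) → Ext.{e} (X i) (W.obj i) n) where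
  toFun z i := (Ext.mk₀ (freeUnit X i)).comp (evalExt z i) (zero_add n)
  map_zero' := by ext i; simp [evalExt_zero]
  map_add' x y := by ext i; simp [evalExt_add]

variable {X Y : Q₀ → A} {W : TwistedRep h t T}

theorem extFree_apply {n : ℕ} (z : Ext.{e'} (free h t T X) W n) (i : Q₀) :
    extFree.{v, u, w₀, w₁, e, e'} X W n z i =
      (Ext.mk₀ (freeUnit X i)).comp (evalExt z i) (zero_add n) := rfl

theorem extFree_mk₀_comp {V : TwistedRep h t T} {n : ℕ} (f : free h t T X ⟶ V)
    (z : Ext.{e'} V W n) (i : Q₀) :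
    extFree.{v, u, w₀, w₁, e, e'} X W n ((Ext.mk₀ f).comp z (zero_add n)) i =
      (Ext.mk₀ (freeUnit X i ≫ f.app i)).comp (evalExt z i) (zero_add n) := by
  rw [extFree_apply, evalExt_comp, evalExt_mk₀, Ext.mk₀_comp_mk₀_assoc]

theorem extFree_freeMap_comp {n : ℕ} (g : ∀ i, X i ⟶ Y i) (z : Ext.{e'} (free h t T Y) W n)
    (i : Q₀) : extFree.{v, u, w₀, w₁, e, e'} X W n ((Ext.mk₀ (freeMap g)).comp z (zero_add n)) i =
      (Ext.mk₀ (g i)).comp (extFree.{v, u, w₀, w₁, e, e'} Y W n z i) (zero_add n) := by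
  rw [extFree_mk₀_comp, freeUnit_map, extFree_apply, Ext.mk₀_comp_mk₀_assoc]

theorem extFree_bijective_zero : Function.Bijective (extFree.{v, u, w₀, w₁, e, e'} X W 0) := by
  have key : ∀ f : free h t T X ⟶ W, extFree.{v, u, w₀, w₁, e, e'} X W 0 (Ext.mk₀ f) =
      fun i => Ext.mk₀ (freeUnit X i ≫ f.app i) := fun f => by
    ext i
    rw [extFree_apply, evalExt_mk₀, Ext.mk₀_comp_mk₀]
  constructor
  · rw [injective_iff_map_eq_zero]
    intro z hz
    obtain ⟨f, rfl⟩ := (Ext.mk₀_bijective _ _).2 z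
    rw [key] at hz
    rw [Ext.mk₀_eq_zero_iff]
    refine free_hom_ext fun i => ?_
    rw [zero_app, comp_zero]
    exact (Ext.mk₀_eq_zero_iff _).1 (congrFun hz i)
  · intro x
    choose f hf using fun i => (Ext.mk₀_bijective (X i) (W.obj i)).2 (x i)
    refine ⟨Ext.mk₀ (freeLift f), ?_⟩
    rw [key]
    ext i
    rw [freeUnit_lift, hf]

variable [HasExactColimitsOfShape (Discrete ℕ) A]

/-- The units `freeUnit` form a morphism from `S i` to the free sequence at `i`, so extension
classes correspond. Thus `extFree` commutes with the connecting maps, which permits dimension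
shifting. -/
theorem extFree_extClass_comp {S : Q₀ → ShortComplex A} (hS : ∀ i, (S i).ShortExact) {n m : ℕ}
    (hm : 1 + n = m) (z : Ext.{e'} (free h t T fun i => (S i).X₁) W n) (i : Q₀) :
    extFree.{v, u, w₀, w₁, e, e'} (fun i => (S i).X₃) W m
      ((freeShortComplex_shortExact (h := h) (t := t) (T := T) hS).extClass.comp z hm) i =
    (hS i).extClass.comp (extFree.{v, u, w₀, w₁, e, e'} (fun i => (S i).X₁) W n z i) hm := by
  have hF := freeShortComplex_shortExact (h := h) (t := t) (T := T) hS
  let φ : S i ⟶ (freeShortComplex h t T S).map (eval h t T i) :=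
    { τ₁ := freeUnit (fun i => (S i).X₁) i
      τ₂ := freeUnit (fun i => (S i).X₂) i
      τ₃ := freeUnit (fun i => (S i).X₃) i
      comm₁₂ := freeUnit_map (fun i => (S i).f) i
      comm₂₃ := freeUnit_map (fun i => (S i).g) i }
  have nat : (hS i).extClass.comp (Ext.mk₀ (freeUnit (fun i => (S i).X₁) i)) (add_zero 1) =
      (Ext.mk₀ (freeUnit (fun i => (S i).X₃) i)).comp (evalExt hF.extClass i) (zero_add 1) := by
    rw [evalExt, Ext.mapExactFunctor_extClass]
    exact (hS i).extClass_naturality (hF.map_of_exact (eval h t T i)) φ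
  rw [extFree_apply, extFree_apply, evalExt_comp,
    ← Ext.comp_assoc (a₂ := 1) (a₁₂ := 1) _ _ _ (zero_add 1) hm (by omega)]
  refine (congrArg (fun x => Ext.comp x _ hm) nat.symm).trans ?_
  exact Ext.comp_assoc_of_second_deg_zero _ _ _ hm

/-- `Ext^n(free X, W) ≅ ∏ Ext^n(X_i, W_i)`. -/
theorem extFree_bijective (n : ℕ) (X : Q₀ → A) :
    Function.Bijective (extFree.{v, u, w₀, w₁, e, e'} X W n) := by
  induction n generalizing X with
  | zero => exact extFree_bijective_zero
  | succ n ih =>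
    constructor
    · rw [injective_iff_map_eq_zero]
      intro z hz
      obtain ⟨P, p, hp, hpz⟩ := Ext.exists_epi_comp_eq_zero z
      -- The epi `p` killing `z` need not come from a family over `X`. Pulling its components back
      -- along the units gives epis onto the `X i`, and the induced map of free representations
      -- factors through `p`, so it kills `z` as well.
      let S : Q₀ → ShortComplex A := fun i =>
        ShortComplex.mk _ _ (kernel.condition (pullback.snd (p.app i) (freeUnit X i)))
      have hS : ∀ i, (S i).ShortExact := fun i =>
        { exact := ShortComplex.exact_kernel _
          epi_g := by dsimp [S]; infer_instance }
      have hF := freeShortComplex_shortExact (h := h) (t := t) (T := T) hS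
      have hfac : freeMap (fun i => (S i).g) =
          freeLift (fun i => pullback.fst (p.app i) (freeUnit X i)) ≫ p := by
        refine free_hom_ext fun i => ?_
        rw [freeUnit_map, comp_app, ← Category.assoc, freeUnit_lift]
        exact pullback.condition.symm
      obtain ⟨w, rfl⟩ := Ext.contravariant_sequence_exact₃ hF W z (by
        change (Ext.mk₀ (freeMap fun i => (S i).g)).comp z (zero_add _) = 0
        rw [hfac, ← Ext.mk₀_comp_mk₀, Ext.comp_assoc_of_second_deg_zero, hpz, Ext.comp_zero])
        (add_comm 1 n)
      -- Now `z` is the extension class times `w`. Its image vanishes, so the components of `w`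
      -- extend to the middle terms; by the induction hypothesis `w` itself does, whence `z = 0`.
      have h₁ : ∀ i, ∃ v : Ext.{e} (S i).X₂ (W.obj i) n, (Ext.mk₀ (S i).f).comp v (zero_add n) =
          extFree.{v, u, w₀, w₁, e, e'} (fun i => (S i).X₁) W n w i := fun i =>
        Ext.contravariant_sequence_exact₁ (hS i) (W.obj i) _ (add_comm 1 n) (by
          rw [← extFree_extClass_comp hS]
          exact congrFun hz i)
      choose v hv using h₁
      obtain ⟨v', rfl⟩ := (ih fun i => (S i).X₂).2 v
      have h₂ : w = (Ext.mk₀ (freeMap fun i => (S i).f)).comp v' (zero_add n) := by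
        apply (ih fun i => (S i).X₁).1
        ext i
        rw [extFree_freeMap_comp, hv]
      rw [h₂]
      exact hF.extClass_comp_assoc v'
    · intro x
      -- For surjectivity the components are effaced separately, and the lower-degree classes so
      -- obtained are lifted by induction.
      choose P p hp hpx using fun i => Ext.exists_epi_comp_eq_zero (x i)
      let S : Q₀ → ShortComplex A := fun i => ShortComplex.mk _ _ (kernel.condition (p i))
      have hS : ∀ i, (S i).ShortExact := fun i => { exact := ShortComplex.exact_kernel _ }
      choose y hy using fun i => Ext.contravariant_sequence_exact₃ (hS i) (W.obj i) (x i) (hpx i)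
        (add_comm 1 n)
      obtain ⟨w, rfl⟩ := (ih fun i => (S i).X₁).2 y
      have hF := freeShortComplex_shortExact (h := h) (t := t) (T := T) hS
      refine ⟨hF.extClass.comp w (add_comm 1 n), ?_⟩
      ext i
      exact (extFree_extClass_comp hS (add_comm 1 n) w i).trans (hy i)

/-- `Ext^n(⨁_{h a = j} T_a(X_{ta}), Z_j)_j ≅ ∏_a Ext^n(T_a(X_{ta}), Z_{ha})`. -/
noncomputable def extStep (X Z : Q₀ → A) (n : ℕ) :
    ((j : Q₀) → Ext.{e} (step h t T X j) (Z j) n) →+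
      ((a : Q₁) → Ext.{e} ((T a).obj (X (t a))) (Z (h a)) n) where
  toFun z a := (Ext.mk₀ (stepι h t T X a)).comp (z (h a)) (zero_add n)
  map_zero' := by ext i; simp
  map_add' x y := by ext i; simp

/-- `Ext` turns the finite coproducts in `step` into products, and the arrows are partitioned by
their heads. -/
theorem extStep_bijective (X Z : Q₀ → A) (n : ℕ) :
    Function.Bijective (extStep.{v, u, w₀, w₁, e} (h := h) (t := t) (T := T) X Z n) := by
  let fin := fun j => Fintype.ofFinite {a : Q₁ // h a = j}
  let E : ∀ j, Ext.{e} (step h t T X j) (Z j) n ≃+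
      ((a : {a : Q₁ // h a = j}) → Ext.{e} ((T a).obj (X (t a))) (Z j) n) :=
    fun j => Ext.biproductAddEquiv (biconeIsBilimitOfColimitCoconeOfIsColimit
    (coproductIsCoproduct fun a : {a : Q₁ // h a = j} => (T a).obj (X (t a)))) (Z j) n
  constructor
  · rw [injective_iff_map_eq_zero]
    intro z hz
    ext j
    apply (E j).injective
    rw [Pi.zero_apply, map_zero]
    ext ⟨a, rfl⟩
    exact congrFun hz a
  · intro y
    refine ⟨fun j => (E j).symm fun a =>
      (y a).comp (Ext.mk₀ (eqToHom (congrArg Z a.2))) (add_zero n), ?_⟩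
    ext a
    exact (congrFun ((E (h a)).apply_symm_apply _) ⟨a, rfl⟩).trans (Ext.comp_mk₀_id _)

/-! ### The long exact sequence -/

section LongExactSequence

variable (V W : TwistedRep h t T)

theorem extFree_stdπ_comp {n : ℕ} (x : Ext.{e'} V W n) :
    extFree.{v, u, w₀, w₁, e, e'} V.obj W n ((Ext.mk₀ V.stdπ).comp x (zero_add n)) =
      extRes.{v, u, w₀, w₁, e, e'} V W n x := by
  ext i
  rw [extFree_mk₀_comp, freeUnit_stdπ, Ext.mk₀_id_comp]
  rfl

/-- On the generators for `a`, `stdD` is a difference of two terms. One gives `f_{ha} ∘ φ_a`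
directly; the other involves the structure map of `free V`, which `evalExt_φ` moves across `z` to
become that of `W`. The order of the terms accounts for the sign. -/
theorem extStep_extFree_stdD_comp {n : ℕ} (z : Ext.{e'} (free h t T V.obj) W n) :
    extStep V.obj W.obj n (extFree.{v, u, w₀, w₁, e, e'} _ W n
      ((Ext.mk₀ V.stdD).comp z (zero_add n))) =
    -extD V W n (extFree.{v, u, w₀, w₁, e, e'} V.obj W n z) := by
  ext a
  change (Ext.mk₀ (stepι h t T V.obj a)).comp (extFree.{v, u, w₀, w₁, e, e'} _ W n
      ((Ext.mk₀ V.stdD).comp z (zero_add n)) (h a)) (zero_add n) =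
    -((Ext.mk₀ (V.φ a)).comp ((Ext.mk₀ (freeUnit V.obj (h a))).comp (evalExt z (h a))
      (zero_add n)) (zero_add n) -
      (((Ext.mk₀ (freeUnit V.obj (t a))).comp (evalExt z (t a))
      (zero_add n)).mapExactFunctor (T a)).comp (Ext.mk₀ (W.φ a)) (add_zero n))
  rw [extFree_mk₀_comp, Ext.mk₀_comp_mk₀_assoc, stepι_freeUnit_stdD, Ext.mapExactFunctor_comp,
    Ext.mapExactFunctor_mk₀, Ext.comp_assoc_of_third_deg_zero, ← evalExt_φ, Ext.mk₀_comp_mk₀_assoc,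
    Ext.mk₀_comp_mk₀_assoc, neg_sub, sub_eq_add_neg, Ext.mk₀_add, Ext.mk₀_neg, Ext.add_comp,
    Ext.neg_comp, sub_eq_add_neg]

/-- Exactness at `Ext^n(free V, W)` for the standard resolution, transported by `extFree`; the sign
does not affect the kernel. -/
theorem exact_extRes_extD (n : ℕ) :
    Function.Exact (extRes.{v, u, w₀, w₁, e, e'} V W n) (extD V W n) := by
  intro x
  obtain ⟨z, rfl⟩ := (extFree_bijective.{v, u, w₀, w₁, e, e'} (W := W) n V.obj).2 x
  rw [← neg_eq_zero, ← extStep_extFree_stdD_comp,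
    map_eq_zero_iff _ (extStep_bijective _ _ _).1, map_eq_zero_iff _ (extFree_bijective _ _).1]
  constructor
  · intro hz
    obtain ⟨y, rfl⟩ := Ext.contravariant_sequence_exact₂ V.std_shortExact W z hz
    exact ⟨y, (extFree_stdπ_comp V W y).symm⟩
  · rintro ⟨y, hy⟩
    rw [← extFree_stdπ_comp] at hy
    rw [← (extFree_bijective _ _).1 hy, Ext.mk₀_comp_mk₀_assoc, stdD_π, Ext.mk₀_zero,
      Ext.zero_comp]

/-- `δ` is multiplication by the class of the standard resolution, read through the identification
`Φ` of its left-hand `Ext` term. -/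
theorem exists_connecting_hom (n : ℕ) :
    ∃ δ : ((a : Q₁) → Ext.{e} ((T a).obj (V.obj (t a))) (W.obj (h a)) n) →+ Ext.{e'} V W (n + 1),
      Function.Exact (extD V W n) δ ∧
      Function.Exact δ (extRes.{v, u, w₀, w₁, e, e'} V W (n + 1)) := by
  let Φ : Ext.{e'} (free h t T (step h t T V.obj)) W n ≃+
      ((a : Q₁) → Ext.{e} ((T a).obj (V.obj (t a))) (W.obj (h a)) n) :=
    (AddEquiv.ofBijective _ (extFree_bijective.{v, u, w₀, w₁, e, e'} (W := W) n _)).trans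
      (AddEquiv.ofBijective _ (extStep_bijective V.obj W.obj n))
  have hΦ : ∀ z, Φ ((Ext.mk₀ V.stdD).comp z (zero_add n)) =
      -extD V W n (extFree.{v, u, w₀, w₁, e, e'} V.obj W n z) :=
    fun z => extStep_extFree_stdD_comp V W z
  let δ₀ : Ext.{e'} (free h t T (step h t T V.obj)) W n →+ Ext.{e'} V W (n + 1) :=
    V.std_shortExact.extClass.precomp W (add_comm 1 n)
  refine ⟨δ₀.comp Φ.symm.toAddMonoidHom, fun y => ?_, fun x => ?_⟩
  · obtain ⟨y, rfl⟩ := Φ.surjective y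
    have : (δ₀.comp Φ.symm.toAddMonoidHom) (Φ y) =
        V.std_shortExact.extClass.comp y (add_comm 1 n) :=
      congrArg δ₀ (Φ.symm_apply_apply y)
    rw [this]
    constructor
    · intro hy
      obtain ⟨z, rfl⟩ := Ext.contravariant_sequence_exact₁ V.std_shortExact W y (add_comm 1 n) hy
      exact ⟨-extFree.{v, u, w₀, w₁, e, e'} V.obj W n z, by rw [map_neg]; exact (hΦ z).symm⟩
    · rintro ⟨x, hx⟩
      obtain ⟨z, rfl⟩ := (extFree_bijective.{v, u, w₀, w₁, e, e'} (W := W) n V.obj).2 x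
      have : y = (Ext.mk₀ V.stdD).comp (-z) (zero_add n) := by
        apply Φ.injective
        rw [hΦ, map_neg, map_neg, neg_neg, hx]
      rw [this]
      exact V.std_shortExact.extClass_comp_assoc (-z)
  · rw [← extFree_stdπ_comp, map_eq_zero_iff _ (extFree_bijective _ _).1]
    constructor
    · intro hx
      obtain ⟨y, rfl⟩ := Ext.contravariant_sequence_exact₃ V.std_shortExact W x hx (add_comm 1 n)
      exact ⟨Φ y, congrArg δ₀ (Φ.symm_apply_apply y)⟩
    · rintro ⟨y, rfl⟩
      exact V.std_shortExact.comp_extClass_assoc _ (add_comm 1 n)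

end LongExactSequence

end QuiverSheaf.TwistedRep

/-! ### The Hom terms -/

namespace QuiverSheaf.TwistedRep

open Abelian

variable {A : Type u} [Category.{v} A] [Abelian A] {Q₀ : Type w₀} {Q₁ : Type w₁}
  {h t : Q₁ → Q₀} {T : Q₁ → A ⥤ A} [∀ a, (T a).Additive] [∀ a, PreservesFiniteColimits (T a)]

theorem homRes_injective (V W : TwistedRep h t T) : Function.Injective (homRes V W) :=
  fun _ _ H => hom_ext (congrFun H)

theorem exact_homRes_homD (V W : TwistedRep h t T) :
    Function.Exact (homRes V W) (homD V W) := by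
  intro f
  constructor
  · intro hf
    exact ⟨{ app := f, comm := fun a => (sub_eq_zero.1 (congrFun hf a)).symm }, rfl⟩
  · rintro ⟨f, rfl⟩
    ext a
    exact sub_eq_zero.2 (f.comm a).symm

theorem extD_mk₀ [∀ a, PreservesFiniteLimits (T a)] [HasExt.{e} A] (V W : TwistedRep h t T)
    (f : ∀ i, V.obj i ⟶ W.obj i) :
    extD.{v, u, w₀, w₁, e} V W 0 (fun i => Ext.mk₀ (f i)) = fun a => Ext.mk₀ (homD V W f a) := by
  ext a
  change (Ext.mk₀ (V.φ a)).comp (Ext.mk₀ (f (h a))) (zero_add 0) -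
    ((Ext.mk₀ (f (t a))).mapExactFunctor (T a)).comp (Ext.mk₀ (W.φ a)) (add_zero 0) =
    Ext.mk₀ (V.φ a ≫ f (h a) - (T a).map (f (t a)) ≫ W.φ a)
  rw [Ext.mapExactFunctor_mk₀, Ext.mk₀_comp_mk₀, Ext.mk₀_comp_mk₀, sub_eq_add_neg, sub_eq_add_neg,
    Ext.mk₀_add, Ext.mk₀_neg]

/-- The case `n = 0` of `exists_connecting_hom`, with `Ext^0` identified with `Hom`; `extD_mk₀`
matches the two forms of `∂`. -/
theorem exists_connecting_hom_zero [Finite Q₁] [∀ a, PreservesFiniteLimits (T a)]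
    [HasColimitsOfShape (Discrete ℕ) A] [∀ a, PreservesColimitsOfShape (Discrete ℕ) (T a)]
    [HasExactColimitsOfShape (Discrete ℕ) A]
    [HasExt.{e} A] [HasExt.{e'} (TwistedRep h t T)] (V W : TwistedRep h t T) :
    ∃ δ : ((a : Q₁) → ((T a).obj (V.obj (t a)) ⟶ W.obj (h a))) →+ Ext.{e'} V W 1,
      Function.Exact (homD V W) δ ∧
      Function.Exact δ (extRes.{v, u, w₀, w₁, e, e'} V W 1) := by
  obtain ⟨δ, h₁, h₂⟩ := exists_connecting_hom.{v, u, w₀, w₁, e, e'} V W 0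
  let Φ : ((a : Q₁) → ((T a).obj (V.obj (t a)) ⟶ W.obj (h a))) ≃+
      ((a : Q₁) → Ext.{e} ((T a).obj (V.obj (t a))) (W.obj (h a)) 0) :=
    AddEquiv.piCongrRight fun a => Ext.addEquiv₀.symm
  have hΦ : ∀ f, Φ (homD V W f) = extD V W 0 (fun i => Ext.mk₀ (f i)) :=
    fun f => (extD_mk₀ V W f).symm
  refine ⟨δ.comp Φ.toAddMonoidHom, fun y => ?_, fun x => ?_⟩
  · refine (h₁ (Φ y)).trans ⟨?_, ?_⟩
    · rintro ⟨x, hx⟩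
      choose f hf using fun i => (Ext.mk₀_bijective (V.obj i) (W.obj i)).2 (x i)
      refine ⟨f, Φ.injective ?_⟩
      rw [hΦ, ← hx]
      exact congrArg _ (funext hf)
    · rintro ⟨f, rfl⟩
      exact ⟨_, (hΦ f).symm⟩
  · refine (h₂ x).trans ⟨?_, ?_⟩
    · rintro ⟨y, rfl⟩
      exact ⟨Φ.symm y, congrArg δ (Φ.apply_symm_apply y)⟩
    · rintro ⟨y, rfl⟩
      exact ⟨Φ y, rfl⟩

end QuiverSheaf.TwistedRep

/-! ### Application to ringed spaces -/

namespace QuiverSheaf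

instance (X : RingedSpace.{u, u}) : HasExactColimitsOfShape (Discrete ℕ) (OMod X) :=
  sheafOfModules_exactCoproducts _ ℕ

instance (X : RingedSpace.{u, u}) (M : OMod X) :
    PreservesColimitsOfShape (Discrete ℕ) (OMod.tensor X M) :=
  have := tensorFunctor_preservesColimits X.sheaf M
  have : PreservesColimitsOfSize.{0, 0} (OMod.tensor X M) :=
    preservesColimitsOfSize_shrink.{0, u, 0, u} _
  inferInstance

end QuiverSheaf

theorem theorem4p1 (X : RingedSpace.{u, u}) {Q₀ : Type w₀} {Q₁ : Type w₁} [Finite Q₀] [Finite Q₁]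
    (h t : Q₁ → Q₀) (M : Q₁ → QuiverSheaf.OMod X) [∀ a, (M a).IsLocallyFree]
    (V W : QuiverSheaf.QSheaf X h t M) :
    Function.Injective (QuiverSheaf.TwistedRep.homRes V W) ∧
    Function.Exact (QuiverSheaf.TwistedRep.homRes V W) (QuiverSheaf.TwistedRep.homD V W) ∧
    (∃ δ₀ : ((a : Q₁) → ((QuiverSheaf.OMod.tensor X (M a)).obj (V.obj (t a)) ⟶ W.obj (h a))) →+
        Abelian.Ext.{max w₀ w₁ (u + 1)} V W 1,
      Function.Exact (QuiverSheaf.TwistedRep.homD V W) δ₀ ∧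
      Function.Exact δ₀ (QuiverSheaf.TwistedRep.extRes V W 1)) ∧
    (∀ n : ℕ, 1 ≤ n →
      Function.Exact (QuiverSheaf.TwistedRep.extRes V W n)
        (QuiverSheaf.TwistedRep.extD V W n) ∧
      ∃ δ : ((a : Q₁) → Abelian.Ext.{u + 1}
            ((QuiverSheaf.OMod.tensor X (M a)).obj (V.obj (t a))) (W.obj (h a)) n) →+
          Abelian.Ext.{max w₀ w₁ (u + 1)} V W (n + 1),
        Function.Exact (QuiverSheaf.TwistedRep.extD V W n) δ ∧
        Function.Exact δ (QuiverSheaf.TwistedRep.extRes V W (n + 1))) := by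
  exact ⟨QuiverSheaf.TwistedRep.homRes_injective V W,
    QuiverSheaf.TwistedRep.exact_homRes_homD V W,
    QuiverSheaf.TwistedRep.exists_connecting_hom_zero V W, fun n _ =>
    ⟨QuiverSheaf.TwistedRep.exact_extRes_extD V W n,
      QuiverSheaf.TwistedRep.exists_connecting_hom V W n⟩⟩
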